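/- Let $M\subset\mathbb R^3$ be a smooth compact embedded surface of revolution about the vertical axis with connected boundary the unit circle $\mathbb S^1\subset\mathbb R^2\times\{0\}$. Thus $M$ is obtained by rotating a unit-speed profile curve $r\mapsto(h(r),z(r))$, $0\le r\le L$, with $h,z\in C^\infty([0,L])$, $h(0)=1$, $z(0)=0$, $h>0$ on $(0,L)$, $h(L)=0$, and $M$ is smooth also at the pole $r=L$. Let $\mathbb D$ be the flat closed unit disk. The Steklov eigenvalues of a compact surface with boundary are the numbers $\sigma$ for which there is a nonzero harmonic function $f$, smooth up to the boundary, with $\partial_\nu f=\sigma f$ on the boundary ($\nu$ the outward unit normal). The Steklov spectra of $M$ and of $\mathbb D$ are sequences $0=\sigma_0<\sigma_1\le\sigma_2\le\cdots\to\infty$, each eigenvalue being repeated according to its multiplicity. Then the following hold. 1. $M$ is Steklov isospectral to the unit disk: $\sigma_k(M)=\sigma_k(\mathbb D)$ for all $k\ge 0$. 2. The Dirichlet-to-Neumann maps $C^\infty(\mathbb S^1)\to C^\infty(\mathbb S^1)$, $u\mapsto\partial_\nu f$ with $f$ the harmonic extension of $u$, are well defined for $M$ and for $\mathbb D$, and they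 coincide. 3. Put $\tau(r)=\int_0^r\frac{1}{h(s)}\,ds$ for $0\le r<L$. For every integer $n\ge1$ and every $c\in\mathbb R$, the unique continuous function $a:[0,L]\to\mathbb R$ with $(ha')'-n^2h^{-1}a=0$ in $(0,L)$, $a(0)=c$ and $a(L)=0$ is given by $a(r)=c\,e^{-n\tau(r)}$ for $r<L$, $a(L)=0$. Moreover, let $n\ge 0$ and let $T_n(\theta)$ be $\cos n\theta$, or $\sin n\theta$ with $n\ge1$. A continuous function on $M$ of the form $f(r,\theta)=a(r)T_n(\theta)$ is harmonic on $M$ (and smooth up to the boundary) if and only if $a(r)=c\,e^{-n\tau(r)}$ on $[0,L)$ for some constant $c$, and then $\partial_\nu f=nf$ on $\partial M$. -/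

import Mathlib

open Set Metric Filter
open scoped ContDiff

noncomputable section

/-- The Euclidean plane. -/
abbrev Plane := EuclideanSpace ℝ (Fin 2)

/-- Euclidean three-space. -/
abbrev Space := EuclideanSpace ℝ (Fin 3)

/-- The point of the unit circle at angle `θ`. -/
def unitVec (θ : ℝ) : Plane := !₂[Real.cos θ, Real.sin θ]

/-- A compact smooth embedded surface with boundary in three-space, of the type of the disk,
given by a global parametrisation `Φ` over the closed disk of radius `R`: the surface is the
image of the closed disk, its boundary is the image of the bounding circle. -/
structure DiskSurface where
  R : ℝ
  R_pos : 0 < R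
  Φ : Plane → Space
  smooth : ContDiffOn ℝ ∞ Φ (closedBall 0 R)
  injOn : InjOn Φ (closedBall 0 R)
  immersion : ∀ x ∈ closedBall (0 : Plane) R,
    Function.Injective (fderivWithin ℝ Φ (closedBall 0 R) x)

namespace DiskSurface

variable (S : DiskSurface)

/-- The parameter domain, a closed disk. Functions on the surface are functions on it. -/
def dom : Set Plane := closedBall 0 S.R

/-- The surface as a subset of space. -/
def carrier : Set Space := S.Φ '' S.dom

/-- The partial derivative in the `i`-th coordinate (one-sided at the boundary). -/
def partialDeriv (i : Fin 2) (f : Plane → ℝ) (x : Plane) : ℝ :=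
  fderivWithin ℝ f S.dom x (EuclideanSpace.single i 1)

/-- The Riemannian metric induced from space, in coordinates: `g i j = ⟪∂ᵢΦ, ∂ⱼΦ⟫`. -/
def metric (x : Plane) : Matrix (Fin 2) (Fin 2) ℝ :=
  Matrix.of fun i j =>
    inner ℝ (fderivWithin ℝ S.Φ S.dom x (EuclideanSpace.single i 1))
      (fderivWithin ℝ S.Φ S.dom x (EuclideanSpace.single j 1))

/-- The Laplace-Beltrami operator
`Δ f = (det g)^(-1/2) ∑ᵢ ∂ᵢ ((det g)^(1/2) ∑ⱼ gⁱʲ ∂ⱼ f)`. -/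
def laplacian (f : Plane → ℝ) (x : Plane) : ℝ :=
  (Real.sqrt (S.metric x).det)⁻¹ *
    ∑ i, S.partialDeriv i
      (fun y => Real.sqrt (S.metric y).det * ∑ j, (S.metric y)⁻¹ i j * S.partialDeriv j f y) x

/-- The outward unit normal (for the induced metric) at a boundary point `x`, in coordinates:
the covector `x` annihilates the tangent line of the boundary, so the normal is `g⁻¹ x` divided
by its length for `g`. -/
def outwardNormal (x : Plane) : Plane :=
  WithLp.toLp 2
    ((Real.sqrt ((fun i => x i) ⬝ᵥ ((S.metric x)⁻¹.mulVec fun i => x i)))⁻¹ •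
      ((S.metric x)⁻¹.mulVec fun i => x i))

/-- The outward normal derivative at a boundary point. -/
def normalDeriv (f : Plane → ℝ) (x : Plane) : ℝ :=
  fderivWithin ℝ f S.dom x (S.outwardNormal x)

/-- `f` is a harmonic function on the surface, smooth up to the boundary. -/
def IsHarmonic (f : Plane → ℝ) : Prop :=
  ContDiffOn ℝ ∞ f S.dom ∧ ∀ x ∈ ball (0 : Plane) S.R, S.laplacian f x = 0

/-- The Steklov eigenfunctions for `σ` (and the zero function). Only the values on the parameter
domain are meaningful; the values outside are normalised to be zero. -/
def steklovEigenfunctions (σ : ℝ) : Set (Plane → ℝ) :=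
  {f | S.IsHarmonic f ∧ (∀ x ∈ sphere (0 : Plane) S.R, S.normalDeriv f x = σ * f x) ∧
    ∀ x, x ∉ S.dom → f x = 0}

/-- The `k`-th Steklov eigenvalue, `k = 0, 1, 2, …`, counted with multiplicity: the least `t` such
that the eigenfunctions for the eigenvalues `σ ≤ t` span a space of dimension at least `k + 1`. -/
def steklovEigenvalue (k : ℕ) : ℝ :=
  sInf {t : ℝ | ((k + 1 : ℕ) : Cardinal) ≤
    Module.rank ℝ (Submodule.span ℝ (⋃ σ ∈ Iic t, S.steklovEigenfunctions σ))}

/-- The sequence `s` lists the Steklov eigenvalues, each repeated according to its multiplicity: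
`0 = s 0 < s 1 ≤ s 2 ≤ … → ∞`. -/
def IsSteklovSpectrum (s : ℕ → ℝ) : Prop :=
  s 0 = 0 ∧ 0 < s 1 ∧ Monotone s ∧ Tendsto s atTop atTop ∧
    ∀ σ : ℝ, Module.rank ℝ (Submodule.span ℝ (S.steklovEigenfunctions σ)) =
      (({k | s k = σ} : Set ℕ).ncard : Cardinal)

end DiskSurface

/-- The space of smooth functions on the unit circle, as smooth functions of the angle with
period `2π`. -/
def CircleSmooth : Submodule ℝ (ℝ → ℝ) where
  carrier := {u | ContDiff ℝ ∞ u ∧ Function.Periodic u (2 * Real.pi)}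
  add_mem' := fun hu hv => ⟨hu.1.add hv.1, hu.2.add hv.2⟩
  zero_mem' := ⟨contDiff_const, fun _ => rfl⟩
  smul_mem' := fun c _ hu => ⟨contDiff_const.smul hu.1, hu.2.smul c⟩

/-- `Λ` is the Dirichlet-to-Neumann map of the surface, whose boundary is identified with the unit
circle by `θ ↦ Φ (R • unitVec θ)`: every smooth function `u` on the circle has a harmonic extension
to the surface, and the normal derivative of the harmonic extension is `Λ u`. -/
def DiskSurface.IsDirichletToNeumann (S : DiskSurface) (Λ : CircleSmooth →ₗ[ℝ] CircleSmooth) :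
    Prop :=
  ∀ u : CircleSmooth,
    (∃ f, S.IsHarmonic f ∧ ∀ θ, f (S.R • unitVec θ) = (u : ℝ → ℝ) θ) ∧
    ∀ f, S.IsHarmonic f → (∀ θ, f (S.R • unitVec θ) = (u : ℝ → ℝ) θ) →
      ∀ θ, S.normalDeriv f (S.R • unitVec θ) = (Λ u : ℝ → ℝ) θ

/-- The linear inclusion of the plane in space as the horizontal plane of height zero. -/
def planeIncl : Plane →L[ℝ] Space :=
  LinearMap.toContinuousLinearMap
    { toFun := fun x => !₂[x 0, x 1, 0]
      map_add' := fun x y => by ext i; fin_cases i <;> simp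
      map_smul' := fun c x => by ext i; fin_cases i <;> simp }

theorem planeIncl_injective : Function.Injective planeIncl := by
  intro x y h
  have h0 : (planeIncl x) 0 = (planeIncl y) 0 := by rw [h]
  have h1 : (planeIncl x) 1 = (planeIncl y) 1 := by rw [h]
  ext i
  fin_cases i
  · exact h0
  · exact h1

/-- The flat closed unit disk, in the horizontal plane of height zero. -/
def unitDisk : DiskSurface where
  R := 1
  R_pos := one_pos
  Φ := planeIncl
  smooth := planeIncl.contDiff.contDiffOn
  injOn := planeIncl_injective.injOn
  immersion := by
    intro x hx
    rw [planeIncl.fderivWithin (uniqueDiffOn_convex (convex_closedBall (0 : Plane) 1)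
      ⟨0, by simp [interior_closedBall]⟩ x hx)]
    exact planeIncl_injective

/-- A smooth surface of revolution about the vertical axis, with connected boundary the unit circle
in the horizontal plane of height zero. The profile curve `r ↦ (h r, z r)`, `0 ≤ r ≤ R`, has unit
speed, starts at the boundary and meets the axis exactly at its end `r = R`. The surface is
parametrised by polar coordinates `(R - r, θ)` about its pole, at distance `R` from the boundary;
the smoothness of the surface at the pole is the smoothness of this parametrisation. -/
structure SurfaceOfRevolution extends DiskSurface where
  h : ℝ → ℝ
  z : ℝ → ℝ
  h_smooth : ContDiffOn ℝ ∞ h (Icc 0 R)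
  z_smooth : ContDiffOn ℝ ∞ z (Icc 0 R)
  h_zero : h 0 = 1
  z_zero : z 0 = 0
  h_pos : ∀ r ∈ Ioo 0 R, 0 < h r
  h_end : h R = 0
  unit_speed : ∀ r ∈ Icc 0 R,
    derivWithin h (Icc 0 R) r ^ 2 + derivWithin z (Icc 0 R) r ^ 2 = 1
  param : ∀ r ∈ Icc 0 R, ∀ θ : ℝ,
    Φ ((R - r) • unitVec θ) = !₂[h r * Real.cos θ, h r * Real.sin θ, z r]

namespace SurfaceOfRevolution

variable (M : SurfaceOfRevolution)

/-- `τ r = ∫₀ʳ 1 / h`, for `0 ≤ r < R`. -/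
def tau (r : ℝ) : ℝ := ∫ s in (0 : ℝ)..r, 1 / M.h s

/-- `a` is a continuous function on `[0, R]` that solves the radial boundary value problem
`(h a')' - n² h⁻¹ a = 0` on `(0, R)`, `a 0 = c`, `a R = 0`. -/
def IsRadialSolution (n : ℕ) (c : ℝ) (a : ℝ → ℝ) : Prop :=
  ContinuousOn a (Icc 0 M.R) ∧
  (∀ r ∈ Ioo 0 M.R, DifferentiableAt ℝ a r ∧
    DifferentiableAt ℝ (fun s => M.h s * deriv a s) r ∧
    deriv (fun s => M.h s * deriv a s) r - (n : ℝ) ^ 2 * (M.h r)⁻¹ * a r = 0) ∧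
  a 0 = c ∧ a M.R = 0

end SurfaceOfRevolution

end

/-! Away from the pole the metric is `dr² + h² dθ² = h² (dτ² + dθ²)`, so `w = e^(-τ + iθ)` is a
conformal map onto the punctured unit disk. In dimension two harmonicity is conformally invariant,
and `h 0 = 1` makes the map an isometry along the boundary, so normal derivatives are preserved as
well. Every claim thus reduces to the flat disk, where `Re zⁿ` and `Im zⁿ` have normal derivative
`n` times themselves.

The delicate point is smoothness of `w` at the pole. With `ρ = R - r`, smoothness of the
parametrisation forces `h = ρ κ(ρ²)` with `κ` smooth, by Hadamard's lemma and Whitney's theorem on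
even functions (`exists_even_profile`), and unit speed gives `κ 0 = 1`. Then `e^(-τ) = ρ Q(ρ²)`
where `2tκQ' = Q(1 - κ)`. Since `1 - κ` is divisible by `t`, this equation has a smooth positive
solution `Q`, and the chart `x ↦ Q(|x|²) x` is smooth on the closed disk (`exists_isRadialProfile`,
`isConformalChart`).

Everything spectral is deduced from a chart `F` satisfying `IsConformalChart`. A power series with
rapidly decreasing coefficients is smooth up to the circle, and its real part composed with `F` is
harmonic. Fourier expansion of the boundary values provides such a series for every smooth datum,
and a maximum principle shows that there is no other harmonic extension (`exists_eqOn_re`). The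
normal derivative replaces `c n` by `n * c n`. Hence the Dirichlet-to-Neumann map is the Fourier
multiplier `n`, and the spectrum is `0, 1, 1, 2, 2, …`, for the surface and for the flat disk, which
is itself a surface of revolution.

The radial equation is `(h d/dr)² a = n² a`, with solutions `e^(±nτ)`; vanishing at the pole
excludes the growing one. -/

/-! ### Calculus on a closed interval: Hadamard's lemma and Whitney's theorem -/

/-- A continuous function on an interval has an antiderivative. -/
theorem exists_hasDerivWithinAt_of_continuousOn {a b : ℝ} (hab : a < b) {p : ℝ → ℝ}
    (hp : ContinuousOn p (Icc a b)) :
    ∃ g g' : ℝ → ℝ, Continuous g' ∧ EqOn g' p (Icc a b) ∧ ∀ x, HasDerivAt g (g' x) x := by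
  have hc : Continuous (IccExtend hab.le ((Icc a b).domRestrict p)) :=
    (continuousOn_iff_continuous_domRestrict.1 hp).Icc_extend'
  refine ⟨fun x => ∫ t in a..x, IccExtend hab.le ((Icc a b).domRestrict p) t,
    IccExtend hab.le ((Icc a b).domRestrict p), hc, fun x hx => ?_, fun x => ?_⟩
  · rw [IccExtend_of_mem _ _ hx]; rfl
  · exact intervalIntegral.integral_hasDerivAt_right (hc.intervalIntegrable _ _)
      (hc.stronglyMeasurableAtFilter _ _) hc.continuousAt

/-- A continuously differentiable function on an interval extends to the line. -/
theorem exists_extension_hasDerivAt {a b : ℝ} (hab : a < b) {φ : ℝ → ℝ}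
    (hφ : ContDiffOn ℝ 1 φ (Icc a b)) :
    ∃ g g' : ℝ → ℝ, Continuous g' ∧ EqOn g φ (Icc a b) ∧
      EqOn g' (derivWithin φ (Icc a b)) (Icc a b) ∧ ∀ x, HasDerivAt g (g' x) x := by
  have hu := uniqueDiffOn_Icc hab
  obtain ⟨g, g', hc, he, hd⟩ := exists_hasDerivWithinAt_of_continuousOn hab
    (hφ.continuousOn_derivWithin hu le_rfl)
  have ha : a ∈ Icc a b := left_mem_Icc.2 hab.le
  refine ⟨fun x => g x + (φ a - g a), g', hc, ?_, he, fun x => (hd x).add_const _⟩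
  refine (convex_Icc a b).eqOn_of_fderivWithin_eq (𝕜 := ℝ)
    (fun x _ => ((hd x).add_const _).differentiableAt.differentiableWithinAt)
    (hφ.differentiableOn one_ne_zero) hu (fun x hx => ?_) ha (by ring)
  rw [← toSpanSingleton_derivWithin, ← toSpanSingleton_derivWithin,
    ((hd x).add_const _).hasDerivWithinAt.derivWithin (hu x hx), he hx]

theorem ContDiffOn.exists_antideriv {a b : ℝ} (hab : a < b) {φ : ℝ → ℝ}
    (hφ : ContDiffOn ℝ ∞ φ (Icc a b)) :
    ∃ g : ℝ → ℝ, ContDiffOn ℝ ∞ g (Icc a b) ∧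
      ∀ x ∈ Icc a b, HasDerivWithinAt g (φ x) (Icc a b) x := by
  have hu := uniqueDiffOn_Icc hab
  obtain ⟨g, g', hc, he, hd⟩ := exists_hasDerivWithinAt_of_continuousOn hab hφ.continuousOn
  have h : ∀ x ∈ Icc a b, HasDerivWithinAt g (φ x) (Icc a b) x := fun x hx => by
    rw [← he hx]; exact (hd x).hasDerivWithinAt
  refine ⟨g, (contDiffOn_infty_iff_derivWithin hu).2
    ⟨fun x hx => (h x hx).differentiableWithinAt, hφ.congr fun x hx => ?_⟩, h⟩
  exact (h x hx).derivWithin (hu x hx)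

/-- Differentiation under the integral sign. The weight `t ^ m` is carried along because each
derivative in `x` raises its exponent by one, so the family of such integrals is closed under
differentiation. -/
theorem hasDerivAt_integral_pow_mul_comp_mul {g g' : ℝ → ℝ} (hc : Continuous g')
    (hd : ∀ x, HasDerivAt g (g' x) x) (m : ℕ) (x : ℝ) :
    HasDerivAt (fun y => ∫ t in (0 : ℝ)..1, t ^ m * g (t * y))
      (∫ t in (0 : ℝ)..1, t ^ (m + 1) * g' (t * x)) x := by
  have hg : Continuous g := continuous_iff_continuousAt.2 fun x => (hd x).continuousAt
  -- This interval contains `t * y` for all `t` in `[0, 1]` and all `y` within distance `1` of `x`.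
  obtain ⟨C, hC⟩ := (isCompact_Icc (a := -(|x| + 1)) (b := |x| + 1)).exists_bound_of_continuousOn
    hc.continuousOn
  refine (intervalIntegral.hasDerivAt_integral_of_dominated_loc_of_deriv_le
    (F' := fun y t => t ^ (m + 1) * g' (t * y)) (bound := fun _ => C)
    (ball_mem_nhds x one_pos) (Eventually.of_forall fun y => ?_) ?_ ?_ ?_ ?_ ?_).2
  · exact Continuous.aestronglyMeasurable (by fun_prop)
  · exact Continuous.intervalIntegrable (by fun_prop) _ _
  · exact Continuous.aestronglyMeasurable (by fun_prop)
  · refine Eventually.of_forall fun t ht y hy => ?_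
    rw [uIoc_of_le zero_le_one] at ht
    have h1 : |t| ≤ 1 := abs_le.2 ⟨by linarith [ht.1], ht.2⟩
    have h2 : |y| ≤ |x| + 1 := by
      have := mem_ball_iff_norm.1 hy
      rw [Real.norm_eq_abs] at this
      linarith [abs_sub_abs_le_abs_sub y x]
    have h3 : |t * y| ≤ |x| + 1 := by
      rw [abs_mul]; nlinarith [abs_nonneg t, abs_nonneg y]
    have h4 := hC _ (abs_le.1 h3)
    rw [norm_mul, norm_pow, Real.norm_eq_abs t]
    have h5 : |t| ^ (m + 1) ≤ 1 := pow_le_one₀ (abs_nonneg t) h1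
    nlinarith [norm_nonneg (g' (t * y)), pow_nonneg (abs_nonneg t) (m + 1)]
  · simp
  · refine Eventually.of_forall fun t _ y _ => ?_
    have h := ((hd (t * y)).comp y ((hasDerivAt_id y).const_mul t)).const_mul (t ^ m)
    refine h.congr_deriv ?_
    simp; ring

theorem ContDiffOn.integral_pow_mul_comp_mul {a b : ℝ} (hab : a < b) (h0 : (0 : ℝ) ∈ Icc a b)
    (n : ℕ) : ∀ (m : ℕ) {φ : ℝ → ℝ}, ContDiffOn ℝ ∞ φ (Icc a b) →
    ContDiffOn ℝ n (fun x => ∫ t in (0 : ℝ)..1, t ^ m * φ (t * x)) (Icc a b) := by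
  have hu := uniqueDiffOn_Icc hab
  have hmem : ∀ x ∈ Icc a b, ∀ t ∈ uIcc (0 : ℝ) 1, t * x ∈ Icc a b := fun x hx t ht => by
    rw [uIcc_of_le zero_le_one] at ht
    have := (convex_Icc a b).smul_mem_of_zero_mem h0 hx ht
    simpa using this
  have key : ∀ (m : ℕ) {φ : ℝ → ℝ}, ContDiffOn ℝ ∞ φ (Icc a b) → ∀ x ∈ Icc a b,
      HasDerivWithinAt (fun x => ∫ t in (0 : ℝ)..1, t ^ m * φ (t * x))
        (∫ t in (0 : ℝ)..1, t ^ (m + 1) * derivWithin φ (Icc a b) (t * x)) (Icc a b) x := by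
    intro m φ hφ x hx
    -- Replacing `φ` by a `C¹` function on the whole line makes two-sided differentiation available
    -- at the endpoints too.
    obtain ⟨g, g', hc, he, he', hd⟩ := exists_extension_hasDerivAt hab (hφ.of_le (by simp))
    have h := (hasDerivAt_integral_pow_mul_comp_mul hc hd m x).hasDerivWithinAt (s := Icc a b)
    have e1 : ∀ y ∈ Icc a b, ∫ t in (0 : ℝ)..1, t ^ m * φ (t * y) =
        ∫ t in (0 : ℝ)..1, t ^ m * g (t * y) := fun y hy =>
      intervalIntegral.integral_congr fun t ht => by simp only [he (hmem y hy t ht)]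
    have e2 : ∫ t in (0 : ℝ)..1, t ^ (m + 1) * derivWithin φ (Icc a b) (t * x) =
        ∫ t in (0 : ℝ)..1, t ^ (m + 1) * g' (t * x) :=
      intervalIntegral.integral_congr fun t ht => by simp only [he' (hmem x hx t ht)]
    rw [e2]
    exact h.congr e1 (e1 x hx)
  induction n with
  | zero =>
    intro m φ hφ
    exact contDiffOn_zero.2 fun x hx => (key m hφ x hx).continuousWithinAt
  | succ n ih =>
    intro m φ hφ
    push_cast
    rw [contDiffOn_succ_iff_derivWithin hu]
    refine ⟨fun x hx => (key m hφ x hx).differentiableWithinAt, by simp, ?_⟩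
    refine (ih (m + 1) ((contDiffOn_infty_iff_derivWithin hu).1 hφ).2).congr fun x hx => ?_
    exact (key m hφ x hx).derivWithin (hu x hx)

/-- Hadamard's lemma on an interval. -/
theorem ContDiffOn.exists_eq_add_mul {a b : ℝ} (hab : a < b) (h0 : (0 : ℝ) ∈ Icc a b) {φ : ℝ → ℝ}
    (hφ : ContDiffOn ℝ ∞ φ (Icc a b)) :
    ∃ ψ : ℝ → ℝ, ContDiffOn ℝ ∞ ψ (Icc a b) ∧ ∀ x ∈ Icc a b, φ x = φ 0 + x * ψ x := by
  have hu := uniqueDiffOn_Icc hab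
  refine ⟨fun x => ∫ t in (0 : ℝ)..1, t ^ 0 * derivWithin φ (Icc a b) (t * x),
    contDiffOn_infty.2 fun n => ContDiffOn.integral_pow_mul_comp_mul hab h0 n 0
      ((contDiffOn_infty_iff_derivWithin hu).1 hφ).2, fun x hx => ?_⟩
  obtain ⟨g, g', hc, he, he', hd⟩ := exists_extension_hasDerivAt hab (hφ.of_le (by simp))
  have hmem : ∀ t ∈ uIcc (0 : ℝ) 1, t * x ∈ Icc a b := fun t ht => by
    rw [uIcc_of_le zero_le_one] at ht
    simpa using (convex_Icc a b).smul_mem_of_zero_mem h0 hx ht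
  have e2 : ∫ t in (0 : ℝ)..1, t ^ 0 * derivWithin φ (Icc a b) (t * x) =
      ∫ t in (0 : ℝ)..1, g' (t * x) :=
    intervalIntegral.integral_congr fun t ht => by simp only [he' (hmem t ht), pow_zero, one_mul]
  have h := intervalIntegral.integral_eq_sub_of_hasDerivAt (a := 0) (b := 1)
    (f := fun t => g (t * x)) (f' := fun t => g' (t * x) * x)
    (fun t _ => by
      simpa [Function.comp_def] using (hd (t * x)).comp t ((hasDerivAt_id t).mul_const x))
    (Continuous.intervalIntegrable (by fun_prop) _ _)
  rw [intervalIntegral.integral_mul_const] at h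
  simp only [e2]
  rw [← he hx, ← he h0, mul_comm, h]
  simp

/-- Whitney's theorem: a smooth even function is a smooth function of the square. -/
theorem ContDiffOn.comp_sqrt_of_even {R : ℝ} (hR : 0 < R) (n : ℕ) : ∀ {k : ℝ → ℝ},
    ContDiffOn ℝ ∞ k (Icc (-R) R) → (∀ x ∈ Icc (-R) R, k (-x) = k x) →
    ContDiffOn ℝ n (fun t => k (Real.sqrt t)) (Icc 0 (R ^ 2)) := by
  have hRR : -R < R := by linarith
  have hu := uniqueDiffOn_Icc hRR
  have hR2 : 0 < R ^ 2 := by positivity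
  have hu2 := uniqueDiffOn_Icc hR2
  have h0 : (0 : ℝ) ∈ Icc (-R) R := ⟨by linarith, hR.le⟩
  have hsq : ∀ t ∈ Icc 0 (R ^ 2), Real.sqrt t ∈ Icc (-R) R := fun t ht =>
    ⟨by linarith [Real.sqrt_nonneg t], Real.sqrt_le_iff.2 ⟨hR.le, ht.2⟩⟩
  -- As `k'` is odd, `k' x = x * ψ x` with `ψ` smooth and even, so `k(√t)` has derivative `k'(√t) /
  -- (2√t) = ψ(√t) / 2`. This is again an even function of `√t`, and the induction on the order of
  -- smoothness closes.
  have key : ∀ {k : ℝ → ℝ}, ContDiffOn ℝ ∞ k (Icc (-R) R) →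
      (∀ x ∈ Icc (-R) R, k (-x) = k x) → ∃ k₁ : ℝ → ℝ, ContDiffOn ℝ ∞ k₁ (Icc (-R) R) ∧
      (∀ x ∈ Icc (-R) R, k₁ (-x) = k₁ x) ∧ ∀ t ∈ Icc 0 (R ^ 2),
        HasDerivWithinAt (fun t => k (Real.sqrt t)) (k₁ (Real.sqrt t)) (Icc 0 (R ^ 2)) t := by
    intro k hk he
    have hk' := (contDiffOn_infty_iff_derivWithin hu).1 hk
    have hodd : ∀ x ∈ Icc (-R) R, derivWithin k (Icc (-R) R) (-x) =
        -derivWithin k (Icc (-R) R) x := fun x hx => by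
      have hx' : -x ∈ Icc (-R) R := ⟨by linarith [hx.2], by linarith [hx.1]⟩
      have h1 := (hk'.1 (-x) hx').hasDerivWithinAt.scomp (h := fun y : ℝ => -y) x
        (hasDerivAt_neg x).hasDerivWithinAt (s := Icc (-R) R)
        (fun y hy => ⟨by linarith [hy.2], by linarith [hy.1]⟩)
      have h2 := h1.congr (f₁ := k) (fun y hy => (he y hy).symm) (he x hx).symm
      have := h2.derivWithin (hu x hx)
      simp at this
      linarith
    obtain ⟨ψ, hψ, hψ'⟩ := hk'.2.exists_eq_add_mul hRR h0
    have hz : derivWithin k (Icc (-R) R) 0 = 0 := by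
      have := hodd 0 h0
      rw [neg_zero] at this
      linarith
    simp only [hz, zero_add] at hψ'
    have hcs : ContinuousOn (fun t => ψ (Real.sqrt t) / 2) (Icc 0 (R ^ 2)) :=
      (hψ.continuousOn.comp Real.continuous_sqrt.continuousOn hsq).div_const _
    have hd : ∀ t ∈ Ioo 0 (R ^ 2), HasDerivAt (fun t => k (Real.sqrt t)) (ψ (Real.sqrt t) / 2) t :=
      fun t ht => by
        have hs := Real.sqrt_pos.2 ht.1
        have hs2 : Real.sqrt t < R := (Real.sqrt_lt' hR).2 ht.2
        have hm : Real.sqrt t ∈ Icc (-R) R := ⟨by linarith, hs2.le⟩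
        have h1 := (hk'.1 _ hm).hasDerivWithinAt.hasDerivAt (Icc_mem_nhds (by linarith) hs2)
        rw [hψ' _ hm] at h1
        refine (h1.comp t (Real.hasDerivAt_sqrt ht.1.ne')).congr_deriv ?_
        field_simp
    have hck : ContinuousOn (fun t => k (Real.sqrt t)) (Icc 0 (R ^ 2)) :=
      hk.continuousOn.comp Real.continuous_sqrt.continuousOn hsq
    refine ⟨fun x => ψ x / 2, hψ.div_const _, fun x hx => ?_, fun t ht => ?_⟩
    · rcases eq_or_ne x 0 with rfl | hx0
      · simp
      · have hx' : -x ∈ Icc (-R) R := ⟨by linarith [hx.2], by linarith [hx.1]⟩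
        have h1 := hodd x hx
        rw [hψ' x hx, hψ' _ hx'] at h1
        have : x * (ψ (-x) - ψ x) = 0 := by linarith
        rcases mul_eq_zero.1 this with h | h
        · exact absurd h hx0
        · simp only; linarith
    -- At the endpoints, in particular at `t = 0` where the square root is not differentiable, the
    -- one-sided derivative is the limit of the interior derivatives.
    · have hlim : ∀ t₀ ∈ Icc 0 (R ^ 2), Tendsto (deriv fun t => k (Real.sqrt t))
          (nhdsWithin t₀ (Ioo 0 (R ^ 2))) (nhds (ψ (Real.sqrt t₀) / 2)) := fun t₀ ht₀ =>
        ((hcs t₀ ht₀).mono Ioo_subset_Icc_self).tendsto.congr'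
          (eventually_mem_nhdsWithin.mono fun t ht => (hd t ht).deriv.symm)
      have hdo : DifferentiableOn ℝ (fun t => k (Real.sqrt t)) (Ioo 0 (R ^ 2)) := fun t ht =>
        (hd t ht).differentiableAt.differentiableWithinAt
      rcases eq_or_lt_of_le ht.1 with rfl | ht1
      · refine (hasDerivWithinAt_Ici_of_tendsto_deriv hdo
          ((hck _ ht).mono Ioo_subset_Icc_self) (Ioo_mem_nhdsGT hR2) ?_).mono Icc_subset_Ici_self
        rw [← nhdsWithin_Ioo_eq_nhdsGT hR2]
        exact hlim _ ht
      · rcases eq_or_lt_of_le ht.2 with rfl | ht2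
        · refine (hasDerivWithinAt_Iic_of_tendsto_deriv hdo
            ((hck _ ht).mono Ioo_subset_Icc_self) (Ioo_mem_nhdsLT hR2) ?_).mono Icc_subset_Iic_self
          rw [← nhdsWithin_Ioo_eq_nhdsLT hR2]
          exact hlim _ ht
        · exact (hd t ⟨ht1, ht2⟩).hasDerivWithinAt
  induction n with
  | zero =>
    intro k hk he
    obtain ⟨k₁, h1, h2, h3⟩ := key hk he
    exact contDiffOn_zero.2 fun x hx => (h3 x hx).continuousWithinAt
  | succ n ih =>
    intro k hk he
    obtain ⟨k₁, h1, h2, h3⟩ := key hk he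
    push_cast
    rw [contDiffOn_succ_iff_derivWithin hu2]
    refine ⟨fun x hx => (h3 x hx).differentiableWithinAt, by simp, ?_⟩
    exact (ih h1 h2).congr fun x hx => (h3 x hx).derivWithin (hu2 x hx)

/-! ### Power series smooth up to the unit circle -/

/-- Rapidly decreasing sequences of coefficients. -/
def RapidDecay (c : ℕ → ℂ) : Prop := ∀ k : ℕ, Summable fun n : ℕ => (n : ℝ) ^ k * ‖c n‖

/-- The power series with coefficients `c`. -/
noncomputable def diskSeries (c : ℕ → ℂ) (z : ℂ) : ℂ := ∑' n, c n * z ^ n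

namespace RapidDecay

variable {c d : ℕ → ℂ}

theorem of_norm_le (hc : RapidDecay c) {K : ℝ} {j : ℕ} (h : ∀ n, ‖d n‖ ≤ K * (n : ℝ) ^ j * ‖c n‖) :
    RapidDecay d := fun k => by
  refine Summable.of_nonneg_of_le (fun n => by positivity) (fun n => ?_) ((hc (k + j)).mul_left K)
  calc (n : ℝ) ^ k * ‖d n‖ ≤ (n : ℝ) ^ k * (K * (n : ℝ) ^ j * ‖c n‖) := by gcongr; exact h n
    _ = K * ((n : ℝ) ^ (k + j) * ‖c n‖) := by ring

theorem add (hc : RapidDecay c) (hd : RapidDecay d) : RapidDecay (c + d) := fun k => by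
  refine Summable.of_nonneg_of_le (fun n => by positivity) (fun n => ?_) ((hc k).add (hd k))
  rw [← mul_add]
  gcongr
  exact norm_add_le _ _

theorem smul (hc : RapidDecay c) (a : ℂ) : RapidDecay (a • c) :=
  hc.of_norm_le (K := ‖a‖) (j := 0) fun n => by simp

theorem natCast_mul (hc : RapidDecay c) : RapidDecay fun n => (n : ℂ) * c n :=
  hc.of_norm_le (K := 1) (j := 1) fun n => by simp

theorem of_finite_support (h : c.support.Finite) : RapidDecay c := fun k =>
  summable_of_hasFiniteSupport (h.subset fun n hn => by
    rw [Function.mem_support] at hn ⊢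
    intro h0
    simp [h0] at hn)

theorem shift (hc : RapidDecay c) : RapidDecay fun n => ((n : ℂ) + 1) * c (n + 1) := fun k => by
  refine Summable.of_nonneg_of_le (fun n => by positivity) (fun n => ?_)
    ((summable_nat_add_iff 1).2 (hc (k + 1)))
  rw [norm_mul, ← mul_assoc, pow_succ]
  have : ‖(n : ℂ) + 1‖ = (n : ℝ) + 1 := by
    rw [← Nat.cast_succ, Complex.norm_natCast]; simp
  rw [this]
  push_cast
  gcongr
  linarith

theorem summable_mul_pow (hc : RapidDecay c) {z : ℂ} (hz : z ∈ closedBall (0 : ℂ) 1) :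
    Summable fun n => c n * z ^ n := by
  have h0 := hc 0
  simp only [pow_zero, one_mul] at h0
  refine Summable.of_norm_bounded h0 fun n => ?_
  rw [norm_mul, norm_pow]
  exact mul_le_of_le_one_right (norm_nonneg _)
    (pow_le_one₀ (norm_nonneg _) (mem_closedBall_zero_iff.1 hz))

end RapidDecay

section

variable {c d : ℕ → ℂ}

theorem diskSeries_add (hc : RapidDecay c) (hd : RapidDecay d) {z : ℂ}
    (hz : z ∈ closedBall (0 : ℂ) 1) : diskSeries (c + d) z = diskSeries c z + diskSeries d z := by
  simp only [diskSeries, Pi.add_apply, add_mul]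
  exact (hc.summable_mul_pow hz).tsum_add (hd.summable_mul_pow hz)

theorem diskSeries_smul (a : ℂ) (c : ℕ → ℂ) (z : ℂ) :
    diskSeries (a • c) z = a * diskSeries c z := by
  simp only [diskSeries, Pi.smul_apply, smul_eq_mul, mul_assoc]
  exact tsum_mul_left

theorem diskSeries_zero (c : ℕ → ℂ) : diskSeries c 0 = c 0 := by
  rw [diskSeries, tsum_eq_single 0 fun n hn => by simp [hn]]
  simp

theorem diskSeries_single (n : ℕ) (a z : ℂ) : diskSeries (Pi.single n a) z = a * z ^ n := by
  rw [diskSeries, tsum_eq_single n fun m hm => by simp [hm]]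
  simp

theorem RapidDecay.single (n : ℕ) (a : ℂ) : RapidDecay (Pi.single n a) :=
  .of_finite_support ((finite_singleton n).subset Pi.support_single_subset)

/-- A first-order Taylor estimate, uniform on the closed disk, whose constant is polynomial in `n`
and hence summable against rapidly decreasing coefficients. This permits termwise differentiation at
points of the circle itself, where the usual radius-of-convergence argument says nothing. -/
theorem norm_pow_sub_pow_sub_le {z w : ℂ} (hz : ‖z‖ ≤ 1) (hw : ‖w‖ ≤ 1) (n : ℕ) :
    ‖z ^ n - w ^ n - n * w ^ (n - 1) * (z - w)‖ ≤ (n : ℝ) ^ 2 * ‖z - w‖ ^ 2 := by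
  induction n with
  | zero => simp
  | succ n ih =>
    -- The second summand costs at most `n * ‖z - w‖ ^ 2`, and `n ^ 2 + n ≤ (n + 1) ^ 2`.
    have e : z ^ (n + 1) - w ^ (n + 1) - ((n + 1 : ℕ) : ℂ) * w ^ (n + 1 - 1) * (z - w) =
        z * (z ^ n - w ^ n - n * w ^ (n - 1) * (z - w)) + n * w ^ (n - 1) * (z - w) ^ 2 := by
      rcases n with _ | m
      · simp
      · simp only [Nat.add_sub_cancel]
        push_cast
        ring
    rw [e]
    refine (norm_add_le _ _).trans ?_
    rw [norm_mul, norm_mul, norm_mul, norm_pow, norm_pow, Complex.norm_natCast]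
    have h1 : ‖w‖ ^ (n - 1) ≤ 1 := pow_le_one₀ (norm_nonneg _) hw
    have h2 : ‖z‖ * ‖z ^ n - w ^ n - n * w ^ (n - 1) * (z - w)‖ ≤ (n : ℝ) ^ 2 * ‖z - w‖ ^ 2 :=
      (mul_le_of_le_one_left (norm_nonneg _) hz).trans ih
    have h3 : (n : ℝ) * ‖w‖ ^ (n - 1) * ‖z - w‖ ^ 2 ≤ n * ‖z - w‖ ^ 2 := by
      gcongr
      exact mul_le_of_le_one_right (Nat.cast_nonneg _) h1
    push_cast
    nlinarith [sq_nonneg ‖z - w‖, (Nat.cast_nonneg n : (0 : ℝ) ≤ n),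
      mul_nonneg (Nat.cast_nonneg n : (0 : ℝ) ≤ n) (sq_nonneg ‖z - w‖)]

theorem hasDerivWithinAt_diskSeries (hc : RapidDecay c) {w : ℂ} (hw : w ∈ closedBall (0 : ℂ) 1) :
    HasDerivWithinAt (diskSeries c) (diskSeries (fun n => ((n : ℂ) + 1) * c (n + 1)) w)
      (closedBall 0 1) w := by
  refine .of_isLittleO ?_
  have hs2 := hc 2
  have hsd : Summable fun n => c n * (n * w ^ (n - 1)) :=
    (summable_nat_add_iff 1).1 <| (hc.shift.summable_mul_pow hw).congr fun n => by
      simp only [Nat.add_sub_cancel]; push_cast; ring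
  have hd : diskSeries (fun n => ((n : ℂ) + 1) * c (n + 1)) w = ∑' n, c n * (n * w ^ (n - 1)) := by
    rw [hsd.tsum_eq_zero_add]
    simp only [diskSeries, Nat.add_sub_cancel, Nat.cast_zero, zero_mul, mul_zero, zero_add]
    exact tsum_congr fun n => by push_cast; ring
  have hb : ∀ z ∈ closedBall (0 : ℂ) 1, ‖diskSeries c z - diskSeries c w -
      (z - w) • diskSeries (fun n => ((n : ℂ) + 1) * c (n + 1)) w‖ ≤
      (∑' n : ℕ, (n : ℝ) ^ 2 * ‖c n‖) * ‖‖z - w‖ ^ 2‖ := fun z hz => by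
    have e : diskSeries c z - diskSeries c w -
        (z - w) • diskSeries (fun n => ((n : ℂ) + 1) * c (n + 1)) w =
        ∑' n, c n * (z ^ n - w ^ n - n * w ^ (n - 1) * (z - w)) := by
      have hz' := hc.summable_mul_pow hz
      have hw' := hc.summable_mul_pow hw
      rw [hd, smul_eq_mul, ← tsum_mul_left, diskSeries, diskSeries, ← hz'.tsum_sub hw',
        ← (hz'.sub hw').tsum_sub (hsd.mul_left _)]
      exact tsum_congr fun n => by ring
    rw [e, norm_pow, norm_norm, ← tsum_mul_right]
    refine tsum_of_norm_bounded (hs2.mul_right _).hasSum fun n => ?_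
    rw [norm_mul]
    have := norm_pow_sub_pow_sub_le (mem_closedBall_zero_iff.1 hz) (mem_closedBall_zero_iff.1 hw) n
    calc _ ≤ ‖c n‖ * ((n : ℝ) ^ 2 * ‖z - w‖ ^ 2) := by gcongr
      _ = _ := by ring
  refine (Asymptotics.IsBigO.of_bound _ (eventually_mem_nhdsWithin.mono hb)).trans_isLittleO ?_
  exact (Asymptotics.isLittleO_pow_sub_sub w one_lt_two).mono nhdsWithin_le_nhds

theorem uniqueDiffOn_closedBall_complex : UniqueDiffOn ℂ (closedBall (0 : ℂ) 1) :=
  (uniqueDiffOn_convex (convex_closedBall (0 : ℂ) 1)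
    ⟨0, by simp [interior_closedBall]⟩ : UniqueDiffOn ℝ (closedBall (0 : ℂ) 1)).mono_field

theorem contDiffOn_diskSeries (hc : RapidDecay c) :
    ContDiffOn ℂ ∞ (diskSeries c) (closedBall 0 1) := by
  refine contDiffOn_infty.2 fun n => ?_
  induction n generalizing c with
  | zero =>
    exact contDiffOn_zero.2 fun z hz => (hasDerivWithinAt_diskSeries hc hz).continuousWithinAt
  | succ n ih =>
    push_cast
    rw [contDiffOn_succ_iff_derivWithin uniqueDiffOn_closedBall_complex]
    refine ⟨fun z hz => (hasDerivWithinAt_diskSeries hc hz).differentiableWithinAt, by simp,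
      (ih hc.shift).congr fun z hz => ?_⟩
    exact (hasDerivWithinAt_diskSeries hc hz).derivWithin (uniqueDiffOn_closedBall_complex z hz)

theorem hasDerivAt_diskSeries (hc : RapidDecay c) {w : ℂ} (hw : w ∈ ball (0 : ℂ) 1) :
    HasDerivAt (diskSeries c) (diskSeries (fun n => ((n : ℂ) + 1) * c (n + 1)) w) w :=
  (hasDerivWithinAt_diskSeries hc (ball_subset_closedBall hw)).hasDerivAt
    (closedBall_mem_nhds_of_mem hw)

theorem diskSeries_shift_mul (hc : RapidDecay c) {w : ℂ} (hw : w ∈ closedBall (0 : ℂ) 1) :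
    diskSeries (fun n => ((n : ℂ) + 1) * c (n + 1)) w * w =
      diskSeries (fun n => (n : ℂ) * c n) w := by
  rw [diskSeries, diskSeries, (hc.natCast_mul.summable_mul_pow hw).tsum_eq_zero_add,
    ← tsum_mul_right]
  simp only [Nat.cast_zero, zero_mul, zero_add]
  exact tsum_congr fun n => by push_cast; ring

/-- The constant coefficient is the value at `0`; differentiation shifts the sequence, so the others
follow by induction. -/
theorem eq_zero_of_diskSeries_eq_zero (hc : RapidDecay c)
    (h : ∀ z ∈ ball (0 : ℂ) 1, diskSeries c z = 0) (n : ℕ) : c n = 0 := by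
  induction n generalizing c with
  | zero => rw [← diskSeries_zero c]; exact h 0 (mem_ball_self one_pos)
  | succ n ih =>
    have h1 : ∀ z ∈ ball (0 : ℂ) 1, diskSeries (fun n => ((n : ℂ) + 1) * c (n + 1)) z = 0 :=
      fun z hz => by
        have h2 : HasDerivAt (diskSeries c) 0 z :=
          (hasDerivAt_const z (0 : ℂ)).congr_of_eventuallyEq
            ((isOpen_ball.mem_nhds hz : ball (0 : ℂ) 1 ∈ nhds z) |> Filter.mem_of_superset <| h)
        exact (hasDerivAt_diskSeries hc hz).unique h2
    have h3 := ih hc.shift h1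
    exact (mul_eq_zero.1 h3).resolve_left (Nat.cast_add_one_ne_zero n)

/-- A holomorphic function with constant real part on a connected open set is constant. Only the
imaginary part of `c 0` remains free. -/
theorem coeff_eq_zero_of_re_diskSeries_eq_zero (hc : RapidDecay c)
    (h : ∀ z ∈ ball (0 : ℂ) 1, (diskSeries c z).re = 0) :
    (c 0).re = 0 ∧ ∀ n, 1 ≤ n → c n = 0 := by
  refine ⟨by rw [← diskSeries_zero c]; exact h 0 (mem_ball_self one_pos), fun n hn => ?_⟩
  have ha : AnalyticOnNhd ℂ (diskSeries c) (ball 0 1) :=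
    DifferentiableOn.analyticOnNhd (fun z hz =>
      (hasDerivAt_diskSeries hc hz).differentiableAt.differentiableWithinAt) isOpen_ball
  obtain ⟨a, h0⟩ := ha.eq_const_of_re_eq_const h isOpen_ball
    ((convex_ball (0 : ℂ) 1).isConnected ⟨0, mem_ball_self one_pos⟩)
  have h1 := eq_zero_of_diskSeries_eq_zero (hc.add (.single 0 (-a))) (fun z hz => by
    rw [diskSeries_add hc (.single 0 (-a)) (ball_subset_closedBall hz), h0 z hz,
      diskSeries_single]
    simp) n
  have : n ≠ 0 := by omega
  simpa [this] using h1

end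

/-! ### Fourier expansion of smooth periodic functions -/

section Fourier

/-- The integral defining the Fourier coefficients, up to normalisation. -/
noncomputable def fourierIntegralCircle (U : ℝ → ℂ) (n : ℤ) : ℂ :=
  ∫ x in (0 : ℝ)..(2 * Real.pi), Complex.exp (-(n * x * Complex.I)) * U x

theorem fourierIntegralCircle_deriv {U : ℝ → ℂ} (hU : ContDiff ℝ ∞ U)
    (hp : Function.Periodic U (2 * Real.pi)) (n : ℤ) :
    fourierIntegralCircle (deriv U) n = n * Complex.I * fourierIntegralCircle U n := by
  have hc : Continuous (deriv U) := hU.continuous_deriv (by simp)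
  have hd : ∀ x : ℝ, HasDerivAt (fun x : ℝ => Complex.exp (-(n * x * Complex.I)))
      (-(n * Complex.I) * Complex.exp (-(n * x * Complex.I))) x := fun x => by
    have h1 : HasDerivAt (fun x : ℝ => -((n : ℂ) * x * Complex.I)) (-(n * 1 * Complex.I)) x :=
      ((((hasDerivAt_id (x : ℂ)).comp_ofReal).const_mul (n : ℂ)).mul_const _).neg
    refine h1.cexp.congr_deriv ?_
    ring
  have h := intervalIntegral.integral_mul_deriv_eq_deriv_mul (a := 0) (b := 2 * Real.pi)
    (fun x _ => hd x) (fun x _ => (hU.differentiable (by simp) x).hasDerivAt)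
    (Continuous.intervalIntegrable (by fun_prop) _ _) (hc.intervalIntegrable _ _)
  have h0 : U (2 * Real.pi) = U 0 := by simpa using hp 0
  have h1 : Complex.exp (-(n * ((2 * Real.pi : ℝ) : ℂ) * Complex.I)) = 1 := by
    rw [Complex.exp_eq_one_iff]
    exact ⟨-n, by push_cast; ring⟩
  rw [h0, h1] at h
  simp only [fourierIntegralCircle]
  rw [h]
  simp only [Complex.ofReal_zero, mul_zero, zero_mul, neg_zero, Complex.exp_zero, sub_self,
    zero_sub, mul_assoc]
  rw [← intervalIntegral.integral_neg, ← intervalIntegral.integral_const_mul,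
    ← intervalIntegral.integral_const_mul]
  exact intervalIntegral.integral_congr fun x _ => by ring_nf

theorem Function.Periodic.deriv' {U : ℝ → ℂ} {p : ℝ} (hp : Function.Periodic U p) :
    Function.Periodic (deriv U) p := fun x => by
  rw [← deriv_comp_add_const]
  exact congrArg (fun f => deriv f x) (funext hp)

/-- Repeated integration by parts: each derivative of `U` contributes one factor `n`, and the zeroth
case is the trivial bound of the integral. -/
theorem exists_norm_fourierIntegralCircle_mul_pow_le (k : ℕ) : ∀ {U : ℝ → ℂ}, ContDiff ℝ ∞ U →
    Function.Periodic U (2 * Real.pi) →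
    ∃ C : ℝ, ∀ n : ℤ, ‖fourierIntegralCircle U n‖ * |(n : ℝ)| ^ k ≤ C := by
  induction k with
  | zero =>
    intro U hU _
    obtain ⟨C, hC⟩ := (isCompact_Icc (a := 0) (b := 2 * Real.pi)).exists_bound_of_continuousOn
      hU.continuous.continuousOn
    refine ⟨C * |2 * Real.pi - 0|, fun n => ?_⟩
    rw [pow_zero, mul_one]
    refine intervalIntegral.norm_integral_le_of_norm_le_const fun x hx => ?_
    rw [uIoc_of_le Real.two_pi_pos.le] at hx
    have : ‖Complex.exp (-(n * x * Complex.I))‖ = 1 := by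
      rw [Complex.norm_exp]; simp
    rw [norm_mul, this, one_mul]
    exact hC x (Ioc_subset_Icc_self hx)
  | succ k ih =>
    intro U hU hp
    have hU' : ContDiff ℝ ∞ (deriv U) := (contDiff_infty_iff_deriv.1 hU).2
    obtain ⟨C, hC⟩ := ih hU' hp.deriv'
    refine ⟨C, fun n => ?_⟩
    have := hC n
    rw [fourierIntegralCircle_deriv hU hp, norm_mul, norm_mul, Complex.norm_I, mul_one,
      Complex.norm_intCast] at this
    calc _ = |(n : ℝ)| * ‖fourierIntegralCircle U n‖ * |(n : ℝ)| ^ k := by ring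
      _ ≤ C := this

theorem hasSum_fourierIntegralCircle {U : ℝ → ℂ} (hU : ContDiff ℝ ∞ U)
    (hp : Function.Periodic U (2 * Real.pi)) (x : ℝ) :
    HasSum (fun n : ℤ => (1 / (2 * Real.pi) : ℝ) * fourierIntegralCircle U n *
      Complex.exp (x * Complex.I) ^ n) (U x) := by
  have : Fact (0 < 2 * Real.pi) := ⟨Real.two_pi_pos⟩
  let f : C(AddCircle (2 * Real.pi), ℂ) :=
    ⟨hp.lift, continuous_coinduced_dom.2 hU.continuous⟩
  have hf : ∀ y : ℝ, f (y : AddCircle (2 * Real.pi)) = U y := fun y => rfl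
  have hcoef : ∀ n : ℤ, fourierCoeff f n = (1 / (2 * Real.pi) : ℝ) * fourierIntegralCircle U n :=
    fun n => by
      rw [fourierCoeff_eq_intervalIntegral f n 0, zero_add, fourierIntegralCircle,
        Complex.real_smul]
      congr 1
      refine intervalIntegral.integral_congr fun y _ => ?_
      simp only [hf, smul_eq_mul, fourier_coe_apply]
      congr 2
      push_cast
      field_simp
  have hsum : Summable (fourierCoeff f) := by
    obtain ⟨C, hC⟩ := exists_norm_fourierIntegralCircle_mul_pow_le 2 hU hp
    have h1 : Summable fun n : ℤ => |1 / (2 * Real.pi)| * (C * (1 / |(n : ℝ)| ^ 2)) := by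
      refine (Summable.mul_left C ?_).mul_left _
      simpa using Real.summable_one_div_int_pow.2 one_lt_two
    refine Summable.of_norm_bounded_eventually h1 ?_
    refine (Filter.mem_of_superset (finite_singleton (0 : ℤ)).compl_mem_cofinite) fun n hn => ?_
    have hn0 : 0 < |(n : ℝ)| := abs_pos.2 (Int.cast_ne_zero.2 hn)
    simp only [mem_ofPred_eq]
    rw [hcoef, norm_mul, Complex.norm_real, Real.norm_eq_abs]
    gcongr
    rw [mul_one_div, le_div_iff₀ (by positivity)]
    exact hC n
  have h := has_pointwise_sum_fourier_series_of_summable hsum (x : AddCircle (2 * Real.pi))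
  rw [hf] at h
  refine h.congr_fun fun n => ?_
  rw [hcoef, smul_eq_mul, fourier_coe_apply, ← Complex.exp_int_mul]
  congr 2
  push_cast
  field_simp

/-- On the unit circle `w⁻¹` is the conjugate of `w`, so `a (-n) * w⁻ⁿ` has the same real part as
`conj (a (-n)) * wⁿ`. Negative frequencies can therefore be folded onto positive ones without
changing the real part. -/
theorem exists_re_diskSeries_eq {u : ℝ → ℝ} (hu : ContDiff ℝ ∞ u)
    (hp : Function.Periodic u (2 * Real.pi)) :
    ∃ c, RapidDecay c ∧ ∀ θ : ℝ, (diskSeries c (Complex.exp (θ * Complex.I))).re = u θ := by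
  have hU : ContDiff ℝ ∞ fun x => (u x : ℂ) := Complex.ofRealCLM.contDiff.comp hu
  have hpU : Function.Periodic (fun x => (u x : ℂ)) (2 * Real.pi) := fun x => by
    simp only [hp x]
  set a : ℤ → ℂ := fun n => (1 / (2 * Real.pi) : ℝ) * fourierIntegralCircle (fun x => (u x : ℂ)) n
    with ha
  let d : ℕ → ℂ := fun n => a n + (starRingEnd ℂ) (a (-n))
  have hd : RapidDecay d := fun k => by
    -- The two extra powers of `n` leave a comparison with the summable sequence `1 / n ^ 2`.
    obtain ⟨C, hC⟩ := exists_norm_fourierIntegralCircle_mul_pow_le (k + 2) hU hpU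
    have hC' : ∀ n : ℤ, ‖a n‖ * |(n : ℝ)| ^ (k + 2) ≤ |1 / (2 * Real.pi)| * C := fun n => by
      rw [ha]
      simp only [norm_mul, Complex.norm_real, Real.norm_eq_abs, mul_assoc]
      gcongr
      exact hC n
    refine Summable.of_norm_bounded_eventually_nat
      ((Real.summable_one_div_nat_pow.2 one_lt_two).mul_left (2 * (|1 / (2 * Real.pi)| * C))) ?_
    filter_upwards [eventually_ge_atTop 1] with n hn
    have hn0 : (0 : ℝ) < n := by exact_mod_cast hn
    rw [norm_mul, norm_norm, norm_pow, Real.norm_natCast, mul_one_div, le_div_iff₀ (by positivity)]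
    have h1 := hC' n
    have h2 := hC' (-n)
    push_cast at h1 h2
    rw [abs_neg, abs_of_pos hn0] at h2
    rw [abs_of_pos hn0] at h1
    have h3 : ‖d n‖ ≤ ‖a n‖ + ‖a (-n)‖ := (norm_add_le _ _).trans (by rw [RCLike.norm_conj])
    calc _ = ‖d n‖ * (n : ℝ) ^ (k + 2) := by ring
      _ ≤ (‖a n‖ + ‖a (-n)‖) * (n : ℝ) ^ (k + 2) := by gcongr
      _ ≤ _ := by linarith
  -- Folding counts the zero frequency twice; one copy is removed.
  have hc : RapidDecay (d + Pi.single 0 (-a 0)) := hd.add (.single _ _)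
  refine ⟨_, hc, fun θ => ?_⟩
  have hz : Complex.exp (θ * Complex.I) ∈ closedBall (0 : ℂ) 1 := by
    simp [Complex.norm_exp_ofReal_mul_I]
  rw [diskSeries_add hd (.single _ _) hz, diskSeries_single]
  have h1 := Complex.hasSum_re (hasSum_fourierIntegralCircle hU hpU θ).nat_add_neg
  have h2 := Complex.hasSum_re (hd.summable_mul_pow hz).hasSum
  have h3 := h2.unique (h1.congr_fun fun n => ?_)
  · rw [← diskSeries] at h3
    simp [h3, ha]
  · have e : (starRingEnd ℂ) (Complex.exp (θ * Complex.I)) = (Complex.exp (θ * Complex.I))⁻¹ := by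
      rw [← Complex.exp_conj, ← Complex.exp_neg]; simp
    have e2 : (a (-n) * Complex.exp (θ * Complex.I) ^ (-(n : ℤ))).re =
        ((starRingEnd ℂ) (a (-n)) * Complex.exp (θ * Complex.I) ^ n).re := by
      rw [← Complex.conj_re, map_mul, map_zpow₀, e, inv_zpow', neg_neg, zpow_natCast]
    rw [Complex.add_re, e2, zpow_natCast, ← Complex.add_re, ← add_mul]

end Fourier

/-! ### Conformal charts, harmonicity and the maximum principle -/

theorem two_le_infty : (2 : WithTop ℕ∞) ≤ ∞ :=
  WithTop.coe_le_coe.2 (le_top : (2 : ℕ∞) ≤ ⊤)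

theorem one_add_one_le_infty : (1 : WithTop ℕ∞) + 1 ≤ ∞ := by
  rw [one_add_one_eq_two]
  exact two_le_infty

/-- Restrict to the line through `x` in the direction `w`. Were the second derivative positive, the
point would also be a local minimum; the restriction would then be locally constant and its second
derivative zero. -/
theorem hessian_nonpos_of_isLocalMax {E : Type*} [NormedAddCommGroup E] [NormedSpace ℝ E]
    {f : E → ℝ} {x : E} (hf : ContDiffAt ℝ 2 f x) (h : IsLocalMax f x) (w : E) :
    fderiv ℝ (fderiv ℝ f) x w w ≤ 0 := by
  by_contra! hpos
  have hl : ∀ t : ℝ, HasDerivAt (fun t : ℝ => x + t • w) w t := fun t => by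
    simpa using ((hasDerivAt_id t).smul_const w).const_add x
  have hl0 : Tendsto (fun t : ℝ => x + t • w) (nhds 0) (nhds x) := by
    simpa using (hl 0).continuousAt.tendsto
  have hd : ∀ᶠ y in nhds x, DifferentiableAt ℝ f y :=
    (hf.eventually (by simp)).mono fun y hy => hy.differentiableAt two_ne_zero
  have h1 : deriv (fun t : ℝ => f (x + t • w)) =ᶠ[nhds 0]
      fun t => fderiv ℝ f (x + t • w) w :=
    (hl0.eventually hd).mono fun t ht => (ht.hasFDerivAt.comp_hasDerivAt t (hl t)).deriv
  have hff : DifferentiableAt ℝ (fderiv ℝ f) (x + (0 : ℝ) • w) := by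
    rw [zero_smul, add_zero]
    exact (hf.fderiv_right (m := 1) le_rfl).differentiableAt one_ne_zero
  have h2 : deriv (deriv fun t : ℝ => f (x + t • w)) 0 = fderiv ℝ (fderiv ℝ f) x w w := by
    rw [h1.deriv_eq]
    have h3 : HasDerivAt (fun t : ℝ => fderiv ℝ f (x + t • w))
        (fderiv ℝ (fderiv ℝ f) (x + (0 : ℝ) • w) w) 0 :=
      hff.hasFDerivAt.comp_hasDerivAt (0 : ℝ) (hl 0)
    have h4 := ((ContinuousLinearMap.apply ℝ ℝ w).hasFDerivAt.comp_hasDerivAt (0 : ℝ) h3).deriv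
    rw [zero_smul, add_zero] at h4
    exact h4
  have hmax : IsLocalMax (fun t : ℝ => f (x + t • w)) 0 := by
    have := hl0.eventually h
    simpa [IsLocalMax, IsMaxFilter] using this
  have hmin : IsLocalMin (fun t : ℝ => f (x + t • w)) 0 := by
    refine isLocalMin_of_deriv_deriv_pos (by rwa [h2]) hmax.deriv_eq_zero ?_
    exact ContinuousAt.comp (g := f) (by simpa using hf.continuousAt) (hl 0).continuousAt
  have hc : (fun t : ℝ => f (x + t • w)) =ᶠ[nhds 0] fun _ => f (x + (0 : ℝ) • w) := by
    filter_upwards [hmax, hmin] with t h1 h2 using le_antisymm h1 h2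
  have : deriv (deriv fun t : ℝ => f (x + t • w)) 0 = 0 := by
    rw [hc.deriv.deriv_eq]; simp
  linarith

namespace DiskSurface

variable (S : DiskSurface)

/-- The coefficients `√(det g) gⁱʲ` of the Laplace-Beltrami operator. -/
noncomputable def conductivity (i j : Fin 2) (x : Plane) : ℝ :=
  Real.sqrt (S.metric x).det * (S.metric x)⁻¹ i j

/-- The components of the vector density `√(det g) grad f`. -/
noncomputable def flux (f : Plane → ℝ) (i : Fin 2) (x : Plane) : ℝ :=
  ∑ j, S.conductivity i j x * fderiv ℝ f x (EuclideanSpace.single j 1)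

variable {S}

theorem dom_mem_nhds {x : Plane} (hx : x ∈ ball (0 : Plane) S.R) : S.dom ∈ nhds x :=
  closedBall_mem_nhds_of_mem hx

theorem uniqueDiffOn_dom : UniqueDiffOn ℝ S.dom :=
  uniqueDiffOn_convex (convex_closedBall (0 : Plane) S.R)
    ⟨0, by simp [dom, interior_closedBall _ S.R_pos.ne', S.R_pos]⟩

theorem partialDeriv_eq {x : Plane} (hx : x ∈ ball (0 : Plane) S.R) (i : Fin 2) (f : Plane → ℝ) :
    S.partialDeriv i f x = fderiv ℝ f x (EuclideanSpace.single i 1) := by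
  rw [partialDeriv, fderivWithin_of_mem_nhds (dom_mem_nhds hx)]

theorem laplacian_eq {x : Plane} (hx : x ∈ ball (0 : Plane) S.R) (f : Plane → ℝ) :
    S.laplacian f x = (Real.sqrt (S.metric x).det)⁻¹ *
      ∑ i, fderiv ℝ (S.flux f i) x (EuclideanSpace.single i 1) := by
  rw [laplacian]
  congr 1
  refine Finset.sum_congr rfl fun i _ => ?_
  rw [partialDeriv_eq hx]
  have : (fun y => Real.sqrt (S.metric y).det * ∑ j, (S.metric y)⁻¹ i j * S.partialDeriv j f y)
      =ᶠ[nhds x] S.flux f i := by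
    filter_upwards [isOpen_ball.mem_nhds hx] with y hy
    simp only [partialDeriv_eq hy, flux, conductivity, Finset.mul_sum, mul_assoc]
  rw [this.fderiv_eq]

variable (S) in
/-- A conformal chart of the surface onto the closed unit disk in the complex plane which is an
isometry along the boundary. -/
structure IsConformalChart (F : Plane → ℂ) : Prop where
  smooth : ContDiffOn ℝ ∞ F S.dom
  mapsTo : MapsTo F S.dom (closedBall 0 1)
  mapsTo_ball : MapsTo F (ball 0 S.R) (ball 0 1)
  boundary : ∀ θ : ℝ, F (S.R • unitVec θ) = Complex.exp (θ * Complex.I)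
  boundary_deriv : ∀ θ : ℝ, fderivWithin ℝ F S.dom (S.R • unitVec θ) (unitVec θ) =
    Complex.exp (θ * Complex.I)
  normal : ∀ θ : ℝ, S.outwardNormal (S.R • unitVec θ) = unitVec θ
  det_pos : ∀ x ∈ ball (0 : Plane) S.R, 0 < (S.metric x).det
  differentiableAt : ∀ x ∈ ball (0 : Plane) S.R, ∀ i j, DifferentiableAt ℝ (S.conductivity i j) x
  symm : ∀ x ∈ ball (0 : Plane) S.R, S.conductivity 1 0 x = S.conductivity 0 1 x
  pos : ∀ x ∈ ball (0 : Plane) S.R, 0 < S.conductivity 0 0 x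
  det_eq_one : ∀ x ∈ ball (0 : Plane) S.R,
    S.conductivity 0 0 x * S.conductivity 1 1 x - S.conductivity 0 1 x ^ 2 = 1
  -- These two equations are the Cauchy-Riemann equations of the surface: the conductivity matrix
  -- applied to the gradient of `F` is `-i` times the rotated gradient.
  beltrami_zero : ∀ x ∈ ball (0 : Plane) S.R,
    ∑ j, (S.conductivity 0 j x : ℂ) * fderiv ℝ F x (EuclideanSpace.single j 1) =
      -Complex.I * fderiv ℝ F x (EuclideanSpace.single 1 1)
  beltrami_one : ∀ x ∈ ball (0 : Plane) S.R,
    ∑ j, (S.conductivity 1 j x : ℂ) * fderiv ℝ F x (EuclideanSpace.single j 1) =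
      Complex.I * fderiv ℝ F x (EuclideanSpace.single 0 1)
  jacobian_pos : ∀ x ∈ ball (0 : Plane) S.R,
    0 < (fderiv ℝ F x (EuclideanSpace.single 0 1)).re * (fderiv ℝ F x (EuclideanSpace.single 1 1)).im
      - (fderiv ℝ F x (EuclideanSpace.single 1 1)).re * (fderiv ℝ F x (EuclideanSpace.single 0 1)).im

namespace IsConformalChart

variable {F : Plane → ℂ} (hF : S.IsConformalChart F) {c : ℕ → ℂ}
include hF

theorem contDiffAt {x : Plane} (hx : x ∈ ball (0 : Plane) S.R) : ContDiffAt ℝ ∞ F x :=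
  hF.smooth.contDiffAt (dom_mem_nhds hx)

theorem contDiffOn_comp (hc : RapidDecay c) : ContDiffOn ℝ ∞ (fun x => diskSeries c (F x)) S.dom :=
  ((contDiffOn_diskSeries hc).restrict_scalars ℝ).comp hF.smooth hF.mapsTo

theorem fderiv_comp (hc : RapidDecay c) {x : Plane} (hx : x ∈ ball (0 : Plane) S.R) (v : Plane) :
    fderiv ℝ (fun x => diskSeries c (F x)) x v =
      diskSeries (fun n => ((n : ℂ) + 1) * c (n + 1)) (F x) * fderiv ℝ F x v := by
  have h1 := (hasDerivAt_diskSeries hc (hF.mapsTo_ball hx)).comp_hasFDerivAt_of_eq x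
    ((hF.contDiffAt hx).differentiableAt (by simp)).hasFDerivAt rfl
  rw [show (fun x => diskSeries c (F x)) = diskSeries c ∘ F from rfl, h1.fderiv]
  simp

/-- By the Beltrami equations the flux of the real part is the rotated gradient of the imaginary
part, its harmonic conjugate. The flux is then divergence-free by symmetry of second derivatives. -/
theorem flux_re_zero (hc : RapidDecay c) {x : Plane} (hx : x ∈ ball (0 : Plane) S.R) :
    S.flux (fun x => (diskSeries c (F x)).re) 0 x =
      (fderiv ℝ (fun x => diskSeries c (F x)) x (EuclideanSpace.single 1 1)).im := by
  have hd := ((hF.contDiffOn_comp hc).contDiffAt (dom_mem_nhds hx)).differentiableAt (by simp)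
  have h1 : ∀ v, fderiv ℝ (fun x => (diskSeries c (F x)).re) x v =
      (fderiv ℝ (fun x => diskSeries c (F x)) x v).re := fun v =>
    congrArg (· v) (Complex.reCLM.hasFDerivAt.comp x hd.hasFDerivAt).fderiv
  have h2 := congrArg (fun z : ℂ =>
    (diskSeries (fun n => ((n : ℂ) + 1) * c (n + 1)) (F x) * z).re) (hF.beltrami_zero x hx)
  simp only [flux, h1, hF.fderiv_comp hc hx, Fin.sum_univ_two] at h2 ⊢
  simp only [Complex.mul_re, Complex.mul_im, Complex.add_re, Complex.add_im, Complex.ofReal_re,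
    Complex.ofReal_im, Complex.neg_re, Complex.neg_im, Complex.I_re, Complex.I_im] at h2 ⊢
  linarith

theorem flux_re_one (hc : RapidDecay c) {x : Plane} (hx : x ∈ ball (0 : Plane) S.R) :
    S.flux (fun x => (diskSeries c (F x)).re) 1 x =
      -(fderiv ℝ (fun x => diskSeries c (F x)) x (EuclideanSpace.single 0 1)).im := by
  have hd := ((hF.contDiffOn_comp hc).contDiffAt (dom_mem_nhds hx)).differentiableAt (by simp)
  have h1 : ∀ v, fderiv ℝ (fun x => (diskSeries c (F x)).re) x v =
      (fderiv ℝ (fun x => diskSeries c (F x)) x v).re := fun v =>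
    congrArg (· v) (Complex.reCLM.hasFDerivAt.comp x hd.hasFDerivAt).fderiv
  have h2 := congrArg (fun z : ℂ =>
    (diskSeries (fun n => ((n : ℂ) + 1) * c (n + 1)) (F x) * z).re) (hF.beltrami_one x hx)
  simp only [flux, h1, hF.fderiv_comp hc hx, Fin.sum_univ_two] at h2 ⊢
  simp only [Complex.mul_re, Complex.mul_im, Complex.add_re, Complex.add_im, Complex.ofReal_re,
    Complex.ofReal_im, Complex.I_re, Complex.I_im] at h2 ⊢
  linarith

/-- The real part of a power series in the chart is harmonic. -/
theorem isHarmonic_re (hc : RapidDecay c) : S.IsHarmonic fun x => (diskSeries c (F x)).re := by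
  refine ⟨Complex.reCLM.contDiff.comp_contDiffOn (hF.contDiffOn_comp hc), fun x hx => ?_⟩
  have hw := (hF.contDiffOn_comp hc).contDiffAt (dom_mem_nhds hx)
  have hd : DifferentiableAt ℝ (fderiv ℝ fun x => diskSeries c (F x)) x :=
    (hw.fderiv_right (m := 1) one_add_one_le_infty).differentiableAt one_ne_zero
  have h2 : ∀ v w : Plane,
      fderiv ℝ (fun y => (fderiv ℝ (fun x => diskSeries c (F x)) y v).im) x w =
      (fderiv ℝ (fderiv ℝ fun x => diskSeries c (F x)) x w v).im := fun v w =>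
    congrArg (· w) (Complex.imCLM.hasFDerivAt.comp x
      ((ContinuousLinearMap.apply ℝ ℂ v).hasFDerivAt.comp x hd.hasFDerivAt)).fderiv
  have e0 : S.flux (fun x => (diskSeries c (F x)).re) 0 =ᶠ[nhds x]
      fun y => (fderiv ℝ (fun x => diskSeries c (F x)) y (EuclideanSpace.single 1 1)).im :=
    (isOpen_ball.eventually_mem hx).mono fun y hy => hF.flux_re_zero hc hy
  have e1 : S.flux (fun x => (diskSeries c (F x)).re) 1 =ᶠ[nhds x]
      fun y => -(fderiv ℝ (fun x => diskSeries c (F x)) y (EuclideanSpace.single 0 1)).im :=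
    (isOpen_ball.eventually_mem hx).mono fun y hy => hF.flux_re_one hc hy
  rw [laplacian_eq hx, Fin.sum_univ_two, e0.fderiv_eq, e1.fderiv_eq, fderiv_fun_neg]
  simp only [neg_apply, h2]
  rw [(hw.isSymmSndFDerivAt (by simpa using two_le_infty)).eq (EuclideanSpace.single 0 1) (EuclideanSpace.single 1 1)]
  simp

theorem sum_fderiv_flux_eq_zero {f : Plane → ℝ} (hf : S.IsHarmonic f)
    {x : Plane} (hx : x ∈ ball (0 : Plane) S.R) :
    ∑ i, fderiv ℝ (S.flux f i) x (EuclideanSpace.single i 1) = 0 := by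
  have h := hf.2 x hx
  rw [laplacian_eq hx] at h
  exact (mul_eq_zero.1 h).resolve_left (inv_ne_zero (Real.sqrt_pos.2 (hF.det_pos x hx)).ne')

theorem differentiableAt_flux {f : Plane → ℝ} {x : Plane} (hx : x ∈ ball (0 : Plane) S.R)
    (hf : ContDiffAt ℝ ∞ f x) (i : Fin 2) : DifferentiableAt ℝ (S.flux f i) x := by
  have hd : DifferentiableAt ℝ (fderiv ℝ f) x :=
    (hf.fderiv_right (m := 1) one_add_one_le_infty).differentiableAt one_ne_zero
  exact DifferentiableAt.fun_sum fun j _ => (hF.differentiableAt x hx i j).mul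
    (hd.clm_apply (differentiableAt_const _))

/-- At a critical point, the divergence of the flux is the trace of the Hessian for the
conductivity. -/
theorem sum_fderiv_flux_of_fderiv_eq_zero {f : Plane → ℝ} {x : Plane}
    (hx : x ∈ ball (0 : Plane) S.R) (hf : ContDiffAt ℝ ∞ f x) (h0 : fderiv ℝ f x = 0) :
    ∑ i, fderiv ℝ (S.flux f i) x (EuclideanSpace.single i 1) =
      ∑ i, ∑ j, S.conductivity i j x *
        fderiv ℝ (fderiv ℝ f) x (EuclideanSpace.single i 1) (EuclideanSpace.single j 1) := by
  have hd : DifferentiableAt ℝ (fderiv ℝ f) x :=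
    (hf.fderiv_right (m := 1) one_add_one_le_infty).differentiableAt one_ne_zero
  refine Finset.sum_congr rfl fun i _ => ?_
  have h1 : ∀ v : Plane, HasFDerivAt (fun y => fderiv ℝ f y v)
      ((ContinuousLinearMap.apply ℝ ℝ v).comp (fderiv ℝ (fderiv ℝ f) x)) x := fun v =>
    (ContinuousLinearMap.apply ℝ ℝ v).hasFDerivAt.comp x hd.hasFDerivAt
  have h2 := HasFDerivAt.fun_sum (u := Finset.univ) fun j _ =>
    (hF.differentiableAt x hx i j).hasFDerivAt.mul (h1 (EuclideanSpace.single j 1))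
  have h3 := congrArg (· (EuclideanSpace.single i 1)) h2.fderiv
  simp only [h0] at h3
  refine h3.trans ?_
  simp

/-- Let `A` be the conductivity matrix, `H` the Hessian and `v = (A₀₀, A₀₁)`. Since `A` is symmetric
with determinant one, `A₀₀ * tr (A H) = H(v, v) + H(e₁, e₁)`, a sum of two nonpositive terms, and
`A₀₀ > 0`. -/
theorem sum_conductivity_hessian_nonpos {f : Plane → ℝ} {x : Plane}
    (hx : x ∈ ball (0 : Plane) S.R) (hf : ContDiffAt ℝ ∞ f x) (hm : IsLocalMax f x) :
    ∑ i, ∑ j, S.conductivity i j x *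
        fderiv ℝ (fderiv ℝ f) x (EuclideanSpace.single i 1) (EuclideanSpace.single j 1) ≤ 0 := by
  have hp := hF.pos x hx
  have h1 := hessian_nonpos_of_isLocalMax (hf.of_le two_le_infty) hm
    (S.conductivity 0 0 x • EuclideanSpace.single 0 1 +
      S.conductivity 0 1 x • EuclideanSpace.single 1 1)
  have h2 := hessian_nonpos_of_isLocalMax (hf.of_le two_le_infty) hm (EuclideanSpace.single 1 1)
  have hs := (hf.isSymmSndFDerivAt (by simpa using two_le_infty)).eq
    (EuclideanSpace.single 0 1) (EuclideanSpace.single 1 1)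
  have hd := hF.det_eq_one x hx
  simp only [map_add, map_smul, add_apply, smul_apply, smul_eq_mul, hs] at h1
  simp only [Fin.sum_univ_two, hF.symm x hx, hs]
  refine nonpos_of_mul_nonpos_right (a := S.conductivity 0 0 x) ?_ hp
  have h3 : S.conductivity 0 0 x * S.conductivity 1 1 x = 1 + S.conductivity 0 1 x ^ 2 := by
    linarith
  nlinarith [h3]

theorem abs_re_le_one {x : Plane} (hx : x ∈ S.dom) : |(F x).re| ≤ 1 :=
  (Complex.abs_re_le_norm _).trans (mem_closedBall_zero_iff.1 (hF.mapsTo hx))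

theorem isHarmonic_re_chart : S.IsHarmonic fun x => (F x).re := by
  have h := hF.isHarmonic_re (RapidDecay.single 1 1)
  simpa [diskSeries_single] using h

/-- The square of the real part of the chart is strictly subharmonic. -/
theorem sum_fderiv_flux_sq_pos {x : Plane} (hx : x ∈ ball (0 : Plane) S.R) :
    0 < ∑ i, fderiv ℝ (S.flux (fun y => (F y).re ^ 2) i) x (EuclideanSpace.single i 1) := by
  have hu : ∀ y ∈ ball (0 : Plane) S.R, ContDiffAt ℝ ∞ (fun y => (F y).re) y := fun y hy =>
    hF.isHarmonic_re_chart.1.contDiffAt (dom_mem_nhds hy)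
  have e : ∀ i, S.flux (fun y => (F y).re ^ 2) i =ᶠ[nhds x]
      fun y => 2 * (F y).re * S.flux (fun y => (F y).re) i y := fun i => by
    filter_upwards [isOpen_ball.mem_nhds hx] with y hy
    have h1 := (((hu y hy).differentiableAt (by simp)).hasFDerivAt.pow 2).fderiv
    simp only [flux, Fin.sum_univ_two, h1]
    simp
    ring
  have h0 := hF.sum_fderiv_flux_eq_zero hF.isHarmonic_re_chart hx
  have hud := ((hu x hx).differentiableAt (by simp)).hasFDerivAt
  have h2 : ∀ i v, fderiv ℝ (S.flux (fun y => (F y).re ^ 2) i) x v =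
      2 * (F x).re * fderiv ℝ (S.flux (fun y => (F y).re) i) x v +
      2 * S.flux (fun y => (F y).re) i x * fderiv ℝ (fun y => (F y).re) x v := fun i v => by
    have h := congrArg (· v) ((hud.const_mul 2).fun_mul
      (hF.differentiableAt_flux hx (hu x hx) i).hasFDerivAt).fderiv
    rw [(e i).fderiv_eq]
    refine h.trans ?_
    simp
    ring
  have h3 : ∀ v, fderiv ℝ (fun y => (F y).re) x v = (fderiv ℝ F x v).re := fun v =>
    congrArg (· v) (Complex.reCLM.hasFDerivAt.comp x
      ((hF.contDiffAt hx).differentiableAt (by simp)).hasFDerivAt).fderiv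
  -- With `u = Re F` harmonic, the divergence for `u²` is twice the pairing of the flux of `u` with
  -- its gradient. Substituting the flux formulas turns this pairing into the Jacobian of `F`.
  have f0 := hF.flux_re_zero (RapidDecay.single 1 1) hx
  have f1 := hF.flux_re_one (RapidDecay.single 1 1) hx
  simp only [diskSeries_single, pow_one, one_mul] at f0 f1
  simp only [Fin.sum_univ_two] at h0 ⊢
  rw [h2, h2, f0, f1, h3, h3]
  have := hF.jacobian_pos x hx
  have e3 : 2 * (F x).re * (fderiv ℝ (S.flux (fun y => (F y).re) 0) x (EuclideanSpace.single 0 1) +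
    fderiv ℝ (S.flux (fun y => (F y).re) 1) x (EuclideanSpace.single 1 1)) = 0 := by
    rw [h0, mul_zero]
  nlinarith

/-- The weak maximum principle by perturbation. If `f x > 0`, add `ε (Re F)²` with `ε = f x / 2`. As
`|Re F| ≤ 1`, boundary values are at most `ε < f x`, so the maximum is interior. There the
divergence of the flux is nonpositive by the Hessian test, yet positive by strict subharmonicity. -/
theorem le_zero_of_isHarmonic {f : Plane → ℝ} (hf : S.IsHarmonic f)
    (h0 : ∀ x ∈ sphere (0 : Plane) S.R, f x = 0) {x : Plane} (hx : x ∈ S.dom) : f x ≤ 0 := by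
  by_contra! hpos
  set ε := f x / 2 with hε
  have hε0 : 0 < ε := by positivity
  have hsq : ContDiffOn ℝ ∞ (fun y => (F y).re ^ 2) S.dom := hF.isHarmonic_re_chart.1.pow 2
  obtain ⟨p, hp, hmax⟩ := (isCompact_closedBall (0 : Plane) S.R).exists_isMaxOn ⟨x, hx⟩
    (hf.1.continuousOn.add (hsq.continuousOn.const_smul ε))
  have hpb : p ∈ ball (0 : Plane) S.R := by
    refine (mem_ball_zero_iff.2 (lt_of_le_of_ne (mem_closedBall_zero_iff.1 hp) fun hn => ?_))
    have h1 := isMaxOn_iff.1 hmax x hx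
    have h2 := h0 p (mem_sphere_zero_iff_norm.2 hn)
    have h3 := hF.abs_re_le_one hp
    have h4 := (sq_le_one_iff_abs_le_one _).2 h3
    simp only [Pi.add_apply, Pi.smul_apply, smul_eq_mul, h2] at h1
    nlinarith [sq_nonneg (F x).re]
  have hfp : ContDiffAt ℝ ∞ f p := hf.1.contDiffAt (dom_mem_nhds hpb)
  have hsp : ∀ y ∈ ball (0 : Plane) S.R, ContDiffAt ℝ ∞ (fun y => (F y).re ^ 2) y := fun y hy =>
    hsq.contDiffAt (dom_mem_nhds hy)
  have hV : ContDiffAt ℝ ∞ (fun y => f y + ε • (F y).re ^ 2) p :=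
    hfp.add ((hsp p hpb).const_smul ε)
  have hm : IsLocalMax (fun y => f y + ε • (F y).re ^ 2) p := hmax.isLocalMax (dom_mem_nhds hpb)
  have h1 := hF.sum_conductivity_hessian_nonpos hpb hV hm
  rw [← hF.sum_fderiv_flux_of_fderiv_eq_zero hpb hV hm.fderiv_eq_zero] at h1
  have e : ∀ i, S.flux (fun y => f y + ε • (F y).re ^ 2) i =ᶠ[nhds p]
      fun y => S.flux f i y + ε * S.flux (fun y => (F y).re ^ 2) i y := fun i => by
    filter_upwards [isOpen_ball.mem_nhds hpb] with y hy
    have h1 := (((hf.1.contDiffAt (dom_mem_nhds hy)).differentiableAt (by simp)).hasFDerivAt.add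
      (((hsp y hy).differentiableAt (by simp)).hasFDerivAt.const_smul ε)).fderiv
    have h1' : fderiv ℝ (fun y => f y + ε • (F y).re ^ 2) y = _ := h1
    simp only [flux, Fin.sum_univ_two, h1']
    simp
    ring
  have h2 : ∀ i v, fderiv ℝ (S.flux (fun y => f y + ε • (F y).re ^ 2) i) p v =
      fderiv ℝ (S.flux f i) p v + ε * fderiv ℝ (S.flux (fun y => (F y).re ^ 2) i) p v :=
    fun i v => by
      have h := congrArg (· v) ((hF.differentiableAt_flux hpb hfp i).hasFDerivAt.fun_add
        ((hF.differentiableAt_flux hpb (hsp p hpb) i).hasFDerivAt.const_mul ε)).fderiv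
      rw [(e i).fderiv_eq]
      exact h.trans (by simp)
  simp only [h2] at h1
  rw [Finset.sum_add_distrib, ← Finset.mul_sum, hF.sum_fderiv_flux_eq_zero hf hpb, zero_add] at h1
  nlinarith [hF.sum_fderiv_flux_sq_pos hpb]

end IsConformalChart

end DiskSurface

/-! ### Boundary values on the circle and the frequency multiplier -/

theorem norm_unitVec (θ : ℝ) : ‖unitVec θ‖ = 1 := by
  rw [EuclideanSpace.norm_eq, Real.sqrt_eq_one]
  simp [unitVec, Fin.sum_univ_two]

theorem exists_eq_norm_smul_unitVec (x : Plane) : ∃ θ : ℝ, x = ‖x‖ • unitVec θ := by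
  refine ⟨Complex.arg ⟨x 0, x 1⟩, ?_⟩
  have hn : ‖x‖ = ‖(⟨x 0, x 1⟩ : ℂ)‖ := by
    rw [EuclideanSpace.norm_eq, Complex.norm_def, Complex.normSq_mk, Fin.sum_univ_two]
    simp [sq]
  rw [hn]
  ext i
  fin_cases i
  · simp [unitVec, Complex.norm_mul_cos_arg]
  · simp [unitVec, Complex.norm_mul_sin_arg]

theorem exp_mul_I_mem_closedBall (θ : ℝ) : Complex.exp (θ * Complex.I) ∈ closedBall (0 : ℂ) 1 := by
  simp [Complex.norm_exp_ofReal_mul_I]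

section Circle

variable {c d : ℕ → ℂ}

theorem RapidDecay.neg (hc : RapidDecay c) : RapidDecay (-c) := by
  simpa using hc.smul (-1)

theorem diskSeries_neg (c : ℕ → ℂ) (z : ℂ) : diskSeries (-c) z = -diskSeries c z := by
  simpa using diskSeries_smul (-1) c z

/-- The maximum modulus principle for `exp` of the series, whose modulus is the exponential of the
real part and equals `1` on the circle. -/
theorem re_diskSeries_nonpos (hc : RapidDecay c)
    (h : ∀ θ : ℝ, (diskSeries c (Complex.exp (θ * Complex.I))).re = 0) {z : ℂ}
    (hz : z ∈ closedBall (0 : ℂ) 1) : (diskSeries c z).re ≤ 0 := by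
  have hd : DiffContOnCl ℂ (fun z => Complex.exp (diskSeries c z)) (ball 0 1) := by
    refine ⟨fun z hz => ((hasDerivAt_diskSeries hc hz).cexp).differentiableAt.differentiableWithinAt,
      ?_⟩
    rw [closure_ball (0 : ℂ) one_ne_zero]
    exact Complex.continuous_exp.comp_continuousOn (contDiffOn_diskSeries hc).continuousOn
  have h1 := Complex.norm_le_of_forall_mem_frontier_norm_le isBounded_ball hd (C := 1)
    (fun w hw => by
      rw [frontier_ball (0 : ℂ) one_ne_zero, mem_sphere_zero_iff_norm] at hw
      have : w = Complex.exp (w.arg * Complex.I) := by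
        conv_lhs => rw [← Complex.norm_mul_exp_arg_mul_I w, hw]
        simp
      rw [this, Complex.norm_exp, h, Real.exp_zero])
    (z := z) (by rwa [closure_ball (0 : ℂ) one_ne_zero])
  rwa [Complex.norm_exp, Real.exp_le_one_iff] at h1

theorem re_diskSeries_eq_zero (hc : RapidDecay c)
    (h : ∀ θ : ℝ, (diskSeries c (Complex.exp (θ * Complex.I))).re = 0) {z : ℂ}
    (hz : z ∈ closedBall (0 : ℂ) 1) : (diskSeries c z).re = 0 := by
  refine le_antisymm (re_diskSeries_nonpos hc h hz) ?_
  have := re_diskSeries_nonpos hc.neg (fun θ => by rw [diskSeries_neg, Complex.neg_re, h, neg_zero])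
    hz
  rw [diskSeries_neg, Complex.neg_re] at this
  linarith

theorem coeff_eq_zero_of_re_circle_eq_zero (hc : RapidDecay c)
    (h : ∀ θ : ℝ, (diskSeries c (Complex.exp (θ * Complex.I))).re = 0) :
    (c 0).re = 0 ∧ ∀ n, 1 ≤ n → c n = 0 :=
  coeff_eq_zero_of_re_diskSeries_eq_zero hc fun _ hz =>
    re_diskSeries_eq_zero hc h (ball_subset_closedBall hz)

theorem re_diskSeries_of_coeff_eq_zero (h0 : (c 0).re = 0) (h : ∀ n, 1 ≤ n → c n = 0) (z : ℂ) :
    (diskSeries c z).re = 0 := by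
  have : c = Pi.single 0 (c 0) := by
    ext n
    rcases Nat.eq_zero_or_pos n with rfl | hn
    · simp
    · simp [h n hn, hn.ne']
  rw [this, diskSeries_single]
  simpa using h0

/-- Boundary values determine the coefficients up to the imaginary part of `c 0`, which the factor
`n` annihilates. Hence the frequency multiplier does not depend on the chosen coefficients, and its
linearity follows. -/
theorem re_diskSeries_natCast_mul_eq_zero (hc : RapidDecay c)
    (h : ∀ θ : ℝ, (diskSeries c (Complex.exp (θ * Complex.I))).re = 0) (z : ℂ) :
    (diskSeries (fun n => (n : ℂ) * c n) z).re = 0 := by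
  have h1 := coeff_eq_zero_of_re_circle_eq_zero hc h
  exact re_diskSeries_of_coeff_eq_zero (by simp) (fun n hn => by simp [h1.2 n hn]) z

theorem contDiff_re_diskSeries_exp (hc : RapidDecay c) :
    ContDiff ℝ ∞ fun θ : ℝ => (diskSeries c (Complex.exp (θ * Complex.I))).re := by
  have h1 : ContDiff ℝ ∞ fun θ : ℝ => Complex.exp (θ * Complex.I) :=
    (Complex.ofRealCLM.contDiff.mul contDiff_const).cexp
  have h2 := ((contDiffOn_diskSeries hc).restrict_scalars ℝ).comp h1.contDiffOn (s := univ)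
    (fun θ _ => exp_mul_I_mem_closedBall θ)
  exact Complex.reCLM.contDiff.comp (contDiffOn_univ.1 h2)

end Circle

/-- Coefficients of a power series whose real part has the given boundary values. -/
noncomputable def circleCoeff (u : CircleSmooth) : ℕ → ℂ :=
  (exists_re_diskSeries_eq u.2.1 u.2.2).choose

theorem rapidDecay_circleCoeff (u : CircleSmooth) : RapidDecay (circleCoeff u) :=
  (exists_re_diskSeries_eq u.2.1 u.2.2).choose_spec.1

theorem re_diskSeries_circleCoeff (u : CircleSmooth) (θ : ℝ) :
    (diskSeries (circleCoeff u) (Complex.exp (θ * Complex.I))).re = (u : ℝ → ℝ) θ :=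
  (exists_re_diskSeries_eq u.2.1 u.2.2).choose_spec.2 θ

/-- The operator that multiplies the `n`-th Fourier mode by `n`. -/
noncomputable def circleMultiplier : CircleSmooth →ₗ[ℝ] CircleSmooth where
  toFun u := ⟨fun θ => (diskSeries (fun n => (n : ℂ) * circleCoeff u n)
      (Complex.exp (θ * Complex.I))).re,
    contDiff_re_diskSeries_exp (rapidDecay_circleCoeff u).natCast_mul, fun θ => by
      simp only [Complex.ofReal_add, add_mul, Complex.exp_add]
      simp⟩
  map_add' u v := by
    ext θ
    have hu := rapidDecay_circleCoeff u
    have hv := rapidDecay_circleCoeff v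
    have h := rapidDecay_circleCoeff (u + v)
    have hz := exp_mul_I_mem_closedBall
    -- The coefficients are merely chosen, so they need not be additive; but the difference of the
    -- two choices has zero real part on the circle.
    have key := re_diskSeries_natCast_mul_eq_zero (h.add (hu.add hv).neg) (fun θ => by
      rw [diskSeries_add h (hu.add hv).neg (hz θ), diskSeries_neg, diskSeries_add hu hv (hz θ)]
      simp [re_diskSeries_circleCoeff]) (Complex.exp (θ * Complex.I))
    have e : (fun n : ℕ => (n : ℂ) * (circleCoeff (u + v) + -(circleCoeff u + circleCoeff v)) n) =
        (fun n : ℕ => (n : ℂ) * circleCoeff (u + v) n) + -((fun n : ℕ => (n : ℂ) * circleCoeff u n) +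
          fun n : ℕ => (n : ℂ) * circleCoeff v n) := by
      ext n; simp; ring
    rw [e, diskSeries_add h.natCast_mul (hu.natCast_mul.add hv.natCast_mul).neg (hz θ),
      diskSeries_neg, diskSeries_add hu.natCast_mul hv.natCast_mul (hz θ)] at key
    simp only [Complex.add_re, Complex.neg_re] at key
    simp only [Submodule.coe_add, Pi.add_apply]
    linarith
  map_smul' a u := by
    ext θ
    have hu := rapidDecay_circleCoeff u
    have h := rapidDecay_circleCoeff (a • u)
    have hz := exp_mul_I_mem_closedBall
    have key := re_diskSeries_natCast_mul_eq_zero (h.add (hu.smul (-a))) (fun θ => by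
      rw [diskSeries_add h (hu.smul _) (hz θ), diskSeries_smul]
      simp [re_diskSeries_circleCoeff]) (Complex.exp (θ * Complex.I))
    have e : (fun n : ℕ => (n : ℂ) * (circleCoeff (a • u) + (-a : ℂ) • circleCoeff u) n) =
        (fun n : ℕ => (n : ℂ) * circleCoeff (a • u) n) +
          (-a : ℂ) • (fun n : ℕ => (n : ℂ) * circleCoeff u n) := by
      ext n; simp; ring
    rw [e, diskSeries_add h.natCast_mul (hu.natCast_mul.smul _) (hz θ), diskSeries_smul] at key
    simp at key
    simp
    linarith

/-! ### Harmonic extension and the Dirichlet-to-Neumann map -/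

namespace DiskSurface

variable {S : DiskSurface} {F : Plane → ℂ} {c : ℕ → ℂ}

theorem smul_unitVec_mem_dom (θ : ℝ) : S.R • unitVec θ ∈ S.dom := by
  rw [dom, mem_closedBall_zero_iff, norm_smul, norm_unitVec, mul_one, Real.norm_of_nonneg S.R_pos.le]

theorem IsHarmonic.congr {f g : Plane → ℝ} (hf : S.IsHarmonic f) (h : EqOn g f S.dom) :
    S.IsHarmonic g := by
  refine ⟨hf.1.congr h, fun x hx => ?_⟩
  rw [← hf.2 x hx, laplacian_eq hx, laplacian_eq hx]
  congr 1
  refine Finset.sum_congr rfl fun i _ => ?_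
  have : S.flux g i =ᶠ[nhds x] S.flux f i := by
    filter_upwards [isOpen_ball.mem_nhds hx] with y hy
    have : g =ᶠ[nhds y] f := Filter.mem_of_superset (dom_mem_nhds hy) h
    simp only [flux, this.fderiv_eq]
  rw [this.fderiv_eq]

theorem normalDeriv_congr {f g : Plane → ℝ} (h : EqOn g f S.dom) {x : Plane} (hx : x ∈ S.dom) :
    S.normalDeriv g x = S.normalDeriv f x := by
  rw [normalDeriv, normalDeriv, fderivWithin_congr h (h hx)]

namespace IsConformalChart

variable (hF : S.IsConformalChart F)
include hF

theorem isHarmonic_sub {f g : Plane → ℝ} (hf : S.IsHarmonic f) (hg : S.IsHarmonic g) :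
    S.IsHarmonic (f - g) := by
  refine ⟨hf.1.sub hg.1, fun x hx => ?_⟩
  have hfd : ∀ y ∈ ball (0 : Plane) S.R, ContDiffAt ℝ ∞ f y := fun y hy =>
    hf.1.contDiffAt (dom_mem_nhds hy)
  have hgd : ∀ y ∈ ball (0 : Plane) S.R, ContDiffAt ℝ ∞ g y := fun y hy =>
    hg.1.contDiffAt (dom_mem_nhds hy)
  have e : ∀ i, fderiv ℝ (S.flux (f - g) i) x = fderiv ℝ (S.flux f i) x - fderiv ℝ (S.flux g i) x :=
    fun i => by
      have : S.flux (f - g) i =ᶠ[nhds x] S.flux f i - S.flux g i := by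
        filter_upwards [isOpen_ball.mem_nhds hx] with y hy
        simp only [flux, Pi.sub_apply, fderiv_sub ((hfd y hy).differentiableAt (by simp))
          ((hgd y hy).differentiableAt (by simp)), ← Finset.sum_sub_distrib, sub_apply, mul_sub]
      rw [this.fderiv_eq, fderiv_sub (hF.differentiableAt_flux hx (hfd x hx) i)
        (hF.differentiableAt_flux hx (hgd x hx) i)]
  rw [laplacian_eq hx]
  simp only [e, sub_apply]
  rw [Finset.sum_sub_distrib, hF.sum_fderiv_flux_eq_zero hf hx, hF.sum_fderiv_flux_eq_zero hg hx]
  simp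

/-- A harmonic function is determined by its boundary values. -/
theorem eqOn_of_isHarmonic {f g : Plane → ℝ} (hf : S.IsHarmonic f) (hg : S.IsHarmonic g)
    (h : ∀ θ : ℝ, f (S.R • unitVec θ) = g (S.R • unitVec θ)) : EqOn f g S.dom := fun x hx => by
  have h0 : ∀ y ∈ sphere (0 : Plane) S.R, f y = g y := fun y hy => by
    obtain ⟨θ, hθ⟩ := exists_eq_norm_smul_unitVec y
    rw [mem_sphere_zero_iff_norm.1 hy] at hθ
    rw [hθ, h]
  have h1 := hF.le_zero_of_isHarmonic (hF.isHarmonic_sub hf hg)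
    (fun y hy => by simp [h0 y hy]) hx
  have h2 := hF.le_zero_of_isHarmonic (hF.isHarmonic_sub hg hf)
    (fun y hy => by simp [h0 y hy]) hx
  simp only [Pi.sub_apply] at h1 h2
  linarith

/-- The chart carries the outward unit normal to `w = e^(iθ)`, so by the chain rule the normal
derivative is the real part of `w * s'(w)`, where `s` is the series. -/
theorem normalDeriv_re (hc : RapidDecay c) (θ : ℝ) :
    S.normalDeriv (fun x => (diskSeries c (F x)).re) (S.R • unitVec θ) =
      (diskSeries (fun n => (n : ℂ) * c n) (Complex.exp (θ * Complex.I))).re := by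
  have hx := smul_unitVec_mem_dom (S := S) θ
  have hd := (hF.smooth.differentiableOn (by simp) _ hx).hasFDerivWithinAt
  have hz := hF.mapsTo hx
  have h1 := (hasDerivWithinAt_diskSeries hc hz).comp_hasFDerivWithinAt _ hd hF.mapsTo
  have h2 := Complex.reCLM.hasFDerivAt.comp_hasFDerivWithinAt _ h1
  have h3 := congrArg (· (unitVec θ)) (h2.fderivWithin (uniqueDiffOn_dom _ hx))
  rw [normalDeriv, hF.normal]
  refine h3.trans ?_
  simp only [ContinuousLinearMap.comp_apply, smul_apply, smul_eq_mul, hF.boundary_deriv,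
    hF.boundary]
  rw [diskSeries_shift_mul hc (exp_mul_I_mem_closedBall θ)]
  rfl

/-- The boundary values of `f` are smooth, so they are the real part of a rapidly decreasing power
series on the circle. Its composition with `F` is harmonic with the same boundary values, and
uniqueness applies. -/
theorem exists_eqOn_re {f : Plane → ℝ} (hf : S.IsHarmonic f) :
    ∃ c, RapidDecay c ∧ EqOn f (fun x => (diskSeries c (F x)).re) S.dom := by
  have h1 : ContDiff ℝ ∞ fun θ : ℝ => S.R • unitVec θ := by
    have : ContDiff ℝ ∞ unitVec := by
      refine contDiff_euclidean.2 fun i => ?_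
      fin_cases i
      · exact Real.contDiff_cos
      · exact Real.contDiff_sin
    exact this.const_smul S.R
  have h2 : ContDiff ℝ ∞ fun θ : ℝ => f (S.R • unitVec θ) :=
    contDiffOn_univ.1 (hf.1.comp h1.contDiffOn (s := univ) fun θ _ => smul_unitVec_mem_dom θ)
  obtain ⟨c, hc, hu⟩ := exists_re_diskSeries_eq h2 (fun θ => by simp [unitVec])
  refine ⟨c, hc, hF.eqOn_of_isHarmonic hf (hF.isHarmonic_re hc) fun θ => ?_⟩
  rw [hF.boundary, hu]

/-- The Dirichlet-to-Neumann map. -/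
theorem isDirichletToNeumann : S.IsDirichletToNeumann circleMultiplier := fun u => by
  have hc := rapidDecay_circleCoeff u
  have hb : ∀ θ : ℝ, (diskSeries (circleCoeff u) (F (S.R • unitVec θ))).re = (u : ℝ → ℝ) θ :=
    fun θ => by rw [hF.boundary, re_diskSeries_circleCoeff]
  refine ⟨⟨_, hF.isHarmonic_re hc, hb⟩, fun f hf hu θ => ?_⟩
  rw [normalDeriv_congr (hF.eqOn_of_isHarmonic hf (hF.isHarmonic_re hc) fun θ => by rw [hu, hb])
    (smul_unitVec_mem_dom θ), hF.normalDeriv_re hc]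
  rfl

end IsConformalChart

end DiskSurface

/-! ### The Steklov spectrum -/

/-- The `k`-th Steklov eigenvalue of the unit disk: `0, 1, 1, 2, 2, …`. -/
def diskFrequency (k : ℕ) : ℕ := (k + 1) / 2

/-- The coefficients of the `k`-th eigenfunction of the unit disk, `Re zⁿ` or `Im zⁿ`. -/
noncomputable def modeCoeff (k : ℕ) : ℕ → ℂ :=
  Pi.single (diskFrequency k) (if Even k then 1 else -Complex.I)

theorem rapidDecay_modeCoeff (k : ℕ) : RapidDecay (modeCoeff k) := .single _ _

theorem diskFrequency_two_mul (n : ℕ) : diskFrequency (2 * n) = n := by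
  unfold diskFrequency; omega

theorem diskFrequency_two_mul_sub_one {n : ℕ} (hn : 1 ≤ n) : diskFrequency (2 * n - 1) = n := by
  unfold diskFrequency; omega

theorem monotone_diskFrequency : Monotone diskFrequency := fun a b h => by
  unfold diskFrequency; omega

theorem finite_diskFrequency_le (t : ℝ) : {k | (diskFrequency k : ℝ) ≤ t}.Finite := by
  refine (finite_Iio (2 * ⌊t⌋₊ + 2)).subset fun k hk => ?_
  have h : (diskFrequency k : ℝ) ≤ t := hk
  have := Nat.le_floor h
  unfold diskFrequency at this
  simp only [mem_Iio]
  omega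

namespace DiskSurface

variable (S : DiskSurface) {F : Plane → ℂ}

/-- The eigenfunctions of the unit disk, pulled back to a surface. -/
noncomputable def mode (F : Plane → ℂ) (k : ℕ) : Plane → ℝ :=
  S.dom.indicator fun x => (diskSeries (modeCoeff k) (F x)).re

variable {S}

theorem mode_eqOn (k : ℕ) : EqOn (S.mode F k) (fun x => (diskSeries (modeCoeff k) (F x)).re) S.dom :=
  fun _ hx => indicator_of_mem hx _

theorem mode_of_notMem (k : ℕ) {x : Plane} (hx : x ∉ S.dom) : S.mode F k x = 0 :=
  indicator_of_notMem hx _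

namespace IsConformalChart

variable (hF : S.IsConformalChart F)
include hF

theorem mode_mem_steklovEigenfunctions (k : ℕ) :
    S.mode F k ∈ S.steklovEigenfunctions (diskFrequency k) := by
  have hc := rapidDecay_modeCoeff k
  refine ⟨(hF.isHarmonic_re hc).congr (mode_eqOn k), fun x hx => ?_, fun x hx => mode_of_notMem k hx⟩
  obtain ⟨θ, hθ⟩ := exists_eq_norm_smul_unitVec x
  rw [mem_sphere_zero_iff_norm.1 hx] at hθ
  have hd := smul_unitVec_mem_dom (S := S) θ
  rw [hθ, normalDeriv_congr (mode_eqOn k) hd, hF.normalDeriv_re hc, mode_eqOn k hd]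
  simp only [hF.boundary]
  have : (fun n : ℕ => (n : ℂ) * modeCoeff k n) = (diskFrequency k : ℂ) • modeCoeff k := by
    ext n
    rcases eq_or_ne n (diskFrequency k) with rfl | h
    · simp
    · simp [modeCoeff, h]
  rw [this, diskSeries_smul, ← Complex.ofReal_natCast, Complex.re_ofReal_mul]

/-- The Steklov condition says that the series with coefficients `(n - σ) * c n` has zero real part
on the circle. So `c n = 0` for every positive `n ≠ σ`, and `Re (c 0) = 0` unless `σ = 0`: at most
one frequency survives. -/
theorem mem_span_of_mem_steklovEigenfunctions {σ : ℝ} {f : Plane → ℝ}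
    (hf : f ∈ S.steklovEigenfunctions σ) :
    f ∈ Submodule.span ℝ (S.mode F '' {k | (diskFrequency k : ℝ) = σ}) := by
  obtain ⟨hh, hn, h0⟩ := hf
  obtain ⟨c, hc, hfc⟩ := hF.exists_eqOn_re hh
  have hn' : ∀ θ : ℝ, (diskSeries ((fun n : ℕ => (n : ℂ) * c n) + (-σ : ℂ) • c)
      (Complex.exp (θ * Complex.I))).re = 0 := fun θ => by
    have hd := smul_unitVec_mem_dom (S := S) θ
    have h1 := hn (S.R • unitVec θ) (by
      rw [mem_sphere_zero_iff_norm, norm_smul, norm_unitVec, mul_one,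
        Real.norm_of_nonneg S.R_pos.le])
    rw [normalDeriv_congr hfc hd, hfc hd, hF.normalDeriv_re hc] at h1
    simp only [hF.boundary] at h1
    rw [diskSeries_add hc.natCast_mul (hc.smul _) (exp_mul_I_mem_closedBall θ), diskSeries_smul,
      Complex.add_re, h1, ← Complex.ofReal_neg, Complex.re_ofReal_mul]
    ring
  obtain ⟨hz0, hz⟩ := coeff_eq_zero_of_re_circle_eq_zero (hc.natCast_mul.add (hc.smul _)) hn'
  have hz0' : σ = 0 ∨ (c 0).re = 0 := by
    simpa using hz0
  have hz' : ∀ n : ℕ, 1 ≤ n → (n : ℝ) ≠ σ → c n = 0 := fun n hn hne => by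
    have h1 := hz n hn
    have h2 : ((n : ℂ) - σ) * c n = 0 := by
      rw [← h1]; simp; ring
    refine (mul_eq_zero.1 h2).resolve_left fun h3 => hne ?_
    exact_mod_cast sub_eq_zero.1 h3
  by_cases hσ : ∃ n : ℕ, (n : ℝ) = σ
  · obtain ⟨n, rfl⟩ := hσ
    have hre : ∀ z ∈ closedBall (0 : ℂ) 1, (diskSeries c z).re = (c n * z ^ n).re := fun z hz => by
      have h1 := re_diskSeries_of_coeff_eq_zero (c := c + Pi.single n (-c n)) (by
        rcases eq_or_ne n 0 with rfl | hn
        · simp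
        · simpa [hn.symm, hn] using hz0') (fun m hm => by
        rcases eq_or_ne m n with rfl | hmn
        · simp
        · simp [hmn, hz' m hm (by exact_mod_cast hmn)]) z
      rw [diskSeries_add hc (.single _ _) hz, diskSeries_single] at h1
      simp only [Complex.add_re, neg_mul, Complex.neg_re] at h1
      linarith
    -- `Re (c zⁿ) = Re c * Re zⁿ - Im c * Im zⁿ`. For `n = 0` there is no sine mode, and the
    -- truncated index `2 * 0 - 1` would name the constant mode, hence the case distinction.
    have he : f = (c n).re • S.mode F (2 * n) +
        (-(c n).im) • (if 1 ≤ n then S.mode F (2 * n - 1) else 0) := by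
      ext x
      by_cases hx : x ∈ S.dom
      · rw [hfc hx]
        simp only [Pi.add_apply, Pi.smul_apply, smul_eq_mul, mode_eqOn _ hx]
        rw [hre _ (hF.mapsTo hx), modeCoeff, diskSeries_single, diskFrequency_two_mul]
        have hev : Even (2 * n) := even_two_mul n
        rw [if_pos hev]
        split_ifs with h1
        · have h3 : ¬ Even (2 * n - 1) := by
            rw [Nat.not_even_iff]; omega
          rw [mode_eqOn _ hx]
          simp only [modeCoeff, diskSeries_single, diskFrequency_two_mul_sub_one h1]
          simp [Complex.mul_re, h3]
          ring
        · have : n = 0 := by omega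
          subst this
          simp
      · rw [h0 x hx]
        simp only [Pi.add_apply, Pi.smul_apply, smul_eq_mul, mode_of_notMem _ hx]
        split_ifs <;> simp [mode_of_notMem _ hx]
    rw [he]
    refine add_mem (Submodule.smul_mem _ _ (Submodule.subset_span ⟨_, ?_, rfl⟩))
      (Submodule.smul_mem _ _ ?_)
    · simp [diskFrequency_two_mul]
    · split_ifs with h1
      · exact Submodule.subset_span ⟨_, by simp [diskFrequency_two_mul_sub_one h1], rfl⟩
      · exact zero_mem _
  · push Not at hσ
    have he : f = 0 := by
      ext x
      by_cases hx : x ∈ S.dom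
      · rw [hfc hx]
        exact re_diskSeries_of_coeff_eq_zero
          (hz0'.resolve_left fun h => hσ 0 (by simp [h])) (fun n hn => hz' n hn (hσ n)) _
      · exact h0 x hx
    rw [he]
    exact zero_mem _

theorem span_steklovEigenfunctions (σ : ℝ) : Submodule.span ℝ (S.steklovEigenfunctions σ) =
    Submodule.span ℝ (S.mode F '' {k | (diskFrequency k : ℝ) = σ}) := by
  refine le_antisymm (Submodule.span_le.2 fun f hf => hF.mem_span_of_mem_steklovEigenfunctions hf)
    (Submodule.span_mono ?_)
  rintro _ ⟨k, rfl, rfl⟩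
  exact hF.mode_mem_steklovEigenfunctions k

theorem span_iUnion_steklovEigenfunctions (t : ℝ) :
    Submodule.span ℝ (⋃ σ ∈ Iic t, S.steklovEigenfunctions σ) =
      Submodule.span ℝ (S.mode F '' {k | (diskFrequency k : ℝ) ≤ t}) := by
  refine le_antisymm (Submodule.span_le.2 fun f hf => ?_) (Submodule.span_mono ?_)
  · simp only [mem_iUnion] at hf
    obtain ⟨σ, hσ, hf⟩ := hf
    refine Submodule.span_mono (image_mono fun k hk => ?_)
      (hF.mem_span_of_mem_steklovEigenfunctions hf)
    have hk' : (diskFrequency k : ℝ) = σ := hk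
    exact hk'.le.trans hσ
  · rintro _ ⟨k, hk, rfl⟩
    exact mem_biUnion (mem_Iic.2 hk) (hF.mode_mem_steklovEigenfunctions k)

/-- On the boundary a linear relation becomes a power series with zero real part. Its coefficient at
a positive frequency `n` is `a (2n) - i a (2n - 1)`, so real and imaginary parts isolate the even
and odd modes. At frequency zero only the real part is known to vanish, which suffices for the
single mode there. -/
theorem linearIndependent_mode : LinearIndependent ℝ (S.mode F) := by
  rw [linearIndependent_iff']
  intro s a ha k hk
  let c : ℕ → ℂ := ∑ j ∈ s, (a j : ℂ) • modeCoeff j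
  have hsum : ∀ z ∈ closedBall (0 : ℂ) 1, ∀ t : Finset ℕ,
      RapidDecay (∑ j ∈ t, (a j : ℂ) • modeCoeff j) ∧
      (diskSeries (∑ j ∈ t, (a j : ℂ) • modeCoeff j) z).re =
        ∑ j ∈ t, a j * (diskSeries (modeCoeff j) z).re := fun z hz t => by
    induction t using Finset.induction_on with
    | empty => exact ⟨.of_finite_support (by simp), by simp [diskSeries]⟩
    | insert j t hj ih =>
      rw [Finset.sum_insert hj, Finset.sum_insert hj]
      have h1 := (rapidDecay_modeCoeff j).smul (a j)
      refine ⟨h1.add ih.1, ?_⟩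
      rw [diskSeries_add h1 ih.1 hz, Complex.add_re, ih.2, diskSeries_smul, Complex.re_ofReal_mul]
  have hc : RapidDecay c := (hsum 0 (by simp) s).1
  have hb : ∀ θ : ℝ, (diskSeries c (Complex.exp (θ * Complex.I))).re = 0 := fun θ => by
    have hd := smul_unitVec_mem_dom (S := S) θ
    rw [(hsum _ (exp_mul_I_mem_closedBall θ) s).2]
    have h1 := congrFun ha (S.R • unitVec θ)
    simpa [Finset.sum_apply, mode_eqOn _ hd, hF.boundary] using h1
  obtain ⟨h0, h1⟩ := coeff_eq_zero_of_re_circle_eq_zero hc hb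
  have hcn : c (diskFrequency k) = ∑ j ∈ s, if diskFrequency j = diskFrequency k then
      (a j : ℂ) * (if Even j then 1 else -Complex.I) else 0 := by
    simp only [c, Finset.sum_apply, Pi.smul_apply, smul_eq_mul, modeCoeff, Pi.single_apply,
      mul_ite, mul_zero, eq_comm]
  by_cases he : Even k
  · have h2 : (c (diskFrequency k)).re = a k := by
      rw [hcn, Complex.re_sum, Finset.sum_eq_single_of_mem k hk fun j _ hjk => ?_]
      · simp [he]
      · split_ifs with h3 h4
        · exact absurd (by unfold diskFrequency at h3; grind) hjk
        · simp
        · simp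
    rw [← h2]
    rcases Nat.eq_zero_or_pos (diskFrequency k) with h | h
    · rw [h, h0]
    · rw [h1 _ h, Complex.zero_re]
  · have h2 : (c (diskFrequency k)).im = -a k := by
      rw [hcn, Complex.im_sum, Finset.sum_eq_single_of_mem k hk fun j _ hjk => ?_]
      · simp [he]
      · split_ifs with h3 h4
        · simp
        · exact absurd (by unfold diskFrequency at h3; grind) hjk
        · simp
    have h3 : 1 ≤ diskFrequency k := by
      unfold diskFrequency; grind
    rw [h1 _ h3, Complex.zero_im] at h2
    linarith

theorem rank_span_mode (A : Set ℕ) :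
    Module.rank ℝ (Submodule.span ℝ (S.mode F '' A)) = Cardinal.mk A := by
  have h := hF.linearIndependent_mode
  have h1 := rank_span (h.comp (Subtype.val : A → ℕ) Subtype.val_injective)
  rw [range_comp, Subtype.range_coe] at h1
  rw [h1, Cardinal.mk_image_eq h.injective]

/-- The rank is the number of modes of frequency at most `t`. Frequencies increase with the index,
so these modes form an initial segment, which has at least `k + 1` elements exactly when it contains
`k`. -/
theorem le_rank_iff (k : ℕ) (t : ℝ) : ((k + 1 : ℕ) : Cardinal) ≤
    Module.rank ℝ (Submodule.span ℝ (⋃ σ ∈ Iic t, S.steklovEigenfunctions σ)) ↔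
      (diskFrequency k : ℝ) ≤ t := by
  rw [hF.span_iUnion_steklovEigenfunctions, hF.rank_span_mode,
    ← Set.cast_ncard (finite_diskFrequency_le t), Nat.cast_le]
  constructor
  · intro h
    by_contra! hlt
    have hsub : {j | (diskFrequency j : ℝ) ≤ t} ⊆ Iio k := fun j hj => by
      by_contra hjk
      have h1 : (diskFrequency k : ℝ) ≤ diskFrequency j :=
        Nat.cast_le.2 (monotone_diskFrequency (not_lt.1 hjk))
      have h2 : (diskFrequency j : ℝ) ≤ t := hj
      linarith
    have := ncard_le_ncard hsub (finite_Iio k)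
    have hk : (Iio k).ncard = k := by rw [ncard_eq_toFinset_card']; simp
    omega
  · intro h
    have hsub : Iic k ⊆ {j | (diskFrequency j : ℝ) ≤ t} := fun j hj =>
      (Nat.cast_le.2 (monotone_diskFrequency hj)).trans h
    have := ncard_le_ncard hsub (finite_diskFrequency_le t)
    have hk : (Iic k).ncard = k + 1 := by rw [ncard_eq_toFinset_card']; simp
    omega

theorem steklovEigenvalue_eq (k : ℕ) : S.steklovEigenvalue k = diskFrequency k := by
  rw [steklovEigenvalue]
  simp only [hF.le_rank_iff]
  exact csInf_Ici

theorem isSteklovSpectrum : S.IsSteklovSpectrum S.steklovEigenvalue := by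
  have h : S.steklovEigenvalue = fun k => (diskFrequency k : ℝ) := funext hF.steklovEigenvalue_eq
  rw [h]
  refine ⟨by simp [diskFrequency], by simp [diskFrequency],
    fun a b hab => Nat.cast_le.2 (monotone_diskFrequency hab), ?_, fun σ => ?_⟩
  · refine tendsto_natCast_atTop_atTop.comp (tendsto_atTop_atTop.2 fun n => ⟨2 * n, fun k hk => ?_⟩)
    rw [← diskFrequency_two_mul n]
    exact monotone_diskFrequency hk
  · rw [hF.span_steklovEigenfunctions, hF.rank_span_mode, Set.cast_ncard]
    exact (finite_diskFrequency_le σ).subset fun k hk => le_of_eq hk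

end IsConformalChart

end DiskSurface

/-! ### The profile curve near the pole and the conformal factor -/

namespace SurfaceOfRevolution

variable (M : SurfaceOfRevolution)

/-- Follow `Φ` along a full diameter. A negative `ρ` is the positive radius `-ρ` at angle `π`, so
the first coordinate is an odd smooth function of `ρ` and the third an even one. Dividing the odd
one by `ρ` leaves an even function, and smooth even functions are smooth in `ρ²`. -/
theorem exists_even_profile : ∃ κ ζ : ℝ → ℝ, ContDiffOn ℝ ∞ κ (Icc 0 (M.R ^ 2)) ∧
    ContDiffOn ℝ ∞ ζ (Icc 0 (M.R ^ 2)) ∧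
    ∀ r ∈ Icc 0 M.R, M.h r = (M.R - r) * κ ((M.R - r) ^ 2) ∧ M.z r = ζ ((M.R - r) ^ 2) := by
  have hR := M.R_pos
  have hline : ∀ ρ ∈ Icc (-M.R) M.R, ρ • unitVec 0 ∈ closedBall (0 : Plane) M.R := fun ρ hρ => by
    rw [mem_closedBall_zero_iff, norm_smul, norm_unitVec, mul_one]
    exact abs_le.2 hρ
  have hΦ : ContDiffOn ℝ ∞ (fun ρ : ℝ => M.Φ (ρ • unitVec 0)) (Icc (-M.R) M.R) :=
    M.smooth.comp (contDiff_id.smul contDiff_const).contDiffOn hline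
  have hcoord : ∀ i, ContDiffOn ℝ ∞ (fun ρ : ℝ => M.Φ (ρ • unitVec 0) i) (Icc (-M.R) M.R) :=
    fun i => contDiffOn_euclidean.1 hΦ i
  have hpos : ∀ ρ ∈ Icc 0 M.R, M.Φ (ρ • unitVec 0) = !₂[M.h (M.R - ρ), 0, M.z (M.R - ρ)] :=
    fun ρ hρ => by
      have := M.param (M.R - ρ) ⟨by linarith [hρ.2], by linarith [hρ.1]⟩ 0
      simpa using this
  have hneg : ∀ ρ ∈ Icc 0 M.R, M.Φ ((-ρ) • unitVec 0) = !₂[-M.h (M.R - ρ), 0, M.z (M.R - ρ)] :=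
    fun ρ hρ => by
      have h1 := M.param (M.R - ρ) ⟨by linarith [hρ.2], by linarith [hρ.1]⟩ Real.pi
      have h2 : (M.R - (M.R - ρ)) • unitVec Real.pi = (-ρ) • unitVec 0 := by
        ext i; fin_cases i <;> simp [unitVec]
      rw [h2] at h1
      simpa using h1
  have hcase : ∀ ρ ∈ Icc (-M.R) M.R, ρ ∈ Icc 0 M.R ∨ -ρ ∈ Icc 0 M.R := fun ρ hρ => by
    rcases le_total 0 ρ with h | h
    · exact .inl ⟨h, hρ.2⟩
    · exact .inr ⟨by linarith, by linarith [hρ.1]⟩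
  have h0mem : (0 : ℝ) ∈ Icc (-M.R) M.R := ⟨by linarith, hR.le⟩
  have hodd : ∀ ρ ∈ Icc (-M.R) M.R, M.Φ ((-ρ) • unitVec 0) 0 = -M.Φ (ρ • unitVec 0) 0 ∧
      M.Φ ((-ρ) • unitVec 0) 2 = M.Φ (ρ • unitVec 0) 2 := fun ρ hρ => by
    rcases hcase ρ hρ with h | h
    · rw [hneg ρ h, hpos ρ h]; simp
    · have := hneg _ h
      rw [neg_neg] at this
      rw [this, hpos _ h]; simp
  obtain ⟨k, hk, hk'⟩ := (hcoord 0).exists_eq_add_mul (by linarith) h0mem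
  have hE0 : M.Φ ((0 : ℝ) • unitVec 0) 0 = 0 := by
    rw [hpos 0 ⟨le_rfl, hR.le⟩]; simp [M.h_end]
  simp only [hE0, zero_add] at hk'
  have hkeven : ∀ ρ ∈ Icc (-M.R) M.R, k (-ρ) = k ρ := fun ρ hρ => by
    rcases eq_or_ne ρ 0 with rfl | h0
    · simp
    · have h1 := (hodd ρ hρ).1
      rw [hk' ρ hρ, hk' (-ρ) ⟨by linarith [hρ.2], by linarith [hρ.1]⟩] at h1
      have h2 : ρ * (k (-ρ) - k ρ) = 0 := by linarith
      linarith [(mul_eq_zero.1 h2).resolve_left h0]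
  refine ⟨fun t => k (Real.sqrt t), fun t => M.Φ (Real.sqrt t • unitVec 0) 2,
    contDiffOn_infty.2 fun n => ContDiffOn.comp_sqrt_of_even hR n hk hkeven,
    contDiffOn_infty.2 fun n => ContDiffOn.comp_sqrt_of_even hR n (hcoord 2)
      fun ρ hρ => (hodd ρ hρ).2, fun r hr => ?_⟩
  have hr0 : 0 ≤ M.R - r := by linarith [hr.2]
  have hrm : M.R - r ∈ Icc 0 M.R := ⟨hr0, by linarith [hr.1]⟩
  have hp := hpos _ hrm
  simp only [Real.sqrt_sq hr0]
  rw [← hk' _ ⟨by linarith, hrm.2⟩, hp]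
  simp

/-- The profile curve of a surface of revolution and a conformal factor, as smooth functions of the
square of the distance from the pole: `κ` and `ζ` describe the surface, `Q` the conformal chart. -/
structure IsRadialProfile (κ ζ Q κ' ζ' Q' : ℝ → ℝ) : Prop where
  smooth_κ : ContDiffOn ℝ ∞ κ (Icc 0 (M.R ^ 2))
  smooth_κ' : ContDiffOn ℝ ∞ κ' (Icc 0 (M.R ^ 2))
  smooth_ζ' : ContDiffOn ℝ ∞ ζ' (Icc 0 (M.R ^ 2))
  smooth_Q : ContDiffOn ℝ ∞ Q (Icc 0 (M.R ^ 2))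
  deriv_κ : ∀ t ∈ Icc 0 (M.R ^ 2), HasDerivWithinAt κ (κ' t) (Icc 0 (M.R ^ 2)) t
  deriv_ζ : ∀ t ∈ Icc 0 (M.R ^ 2), HasDerivWithinAt ζ (ζ' t) (Icc 0 (M.R ^ 2)) t
  deriv_Q : ∀ t ∈ Icc 0 (M.R ^ 2), HasDerivWithinAt Q (Q' t) (Icc 0 (M.R ^ 2)) t
  h_eq : ∀ r ∈ Icc 0 M.R, M.h r = (M.R - r) * κ ((M.R - r) ^ 2)
  z_eq : ∀ r ∈ Icc 0 M.R, M.z r = ζ ((M.R - r) ^ 2)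
  κ_pos : ∀ t ∈ Icc 0 (M.R ^ 2), 0 < κ t
  Q_pos : ∀ t ∈ Icc 0 (M.R ^ 2), 0 < Q t
  unit_speed : ∀ t ∈ Icc 0 (M.R ^ 2), (κ t + 2 * t * κ' t) ^ 2 + 4 * t * ζ' t ^ 2 = 1
  conformal : ∀ t ∈ Icc 0 (M.R ^ 2), 2 * t * κ t * Q' t = Q t * (1 - κ t)
  Q_end : M.R * Q (M.R ^ 2) = 1

/-- The equation for `Q` reads `(log Q)' = (1 - κ) / (2tκ)`, singular at `t = 0` unless `κ 0 = 1`.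
Unit speed at the pole supplies this value, after which the right side is smooth and an
antiderivative can be taken. -/
theorem exists_isRadialProfile :
    ∃ κ ζ Q κ' ζ' Q' : ℝ → ℝ, M.IsRadialProfile κ ζ Q κ' ζ' Q' := by
  obtain ⟨κ, ζ, hκ, hζ, hp⟩ := M.exists_even_profile
  have hR := M.R_pos
  have hR2 : 0 < M.R ^ 2 := by positivity
  have hu := uniqueDiffOn_Icc hR2
  have huR := uniqueDiffOn_Icc hR
  have hκ' := (contDiffOn_infty_iff_derivWithin hu).1 hκ
  have hζ' := (contDiffOn_infty_iff_derivWithin hu).1 hζ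
  have h0 : (0 : ℝ) ∈ Icc 0 (M.R ^ 2) := ⟨le_rfl, hR2.le⟩
  have hmaps : MapsTo (fun r => (M.R - r) ^ 2) (Icc 0 M.R) (Icc 0 (M.R ^ 2)) := fun r hr =>
    ⟨sq_nonneg _, by
      have := hr.1; have := hr.2
      exact pow_le_pow_left₀ (by linarith) (by linarith) 2⟩
  have hroot : ∀ t ∈ Icc 0 (M.R ^ 2), M.R - Real.sqrt t ∈ Icc 0 M.R ∧
      (M.R - (M.R - Real.sqrt t)) ^ 2 = t ∧ M.R - (M.R - Real.sqrt t) = Real.sqrt t := fun t ht => by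
    have h1 : Real.sqrt t ≤ M.R := Real.sqrt_le_iff.2 ⟨hR.le, ht.2⟩
    refine ⟨⟨by linarith, by linarith [Real.sqrt_nonneg t]⟩, ?_, by ring⟩
    rw [sub_sub_cancel, Real.sq_sqrt ht.1]
  have hinner : ∀ r, HasDerivWithinAt (fun r => (M.R - r) ^ 2) (-(2 * (M.R - r))) (Icc 0 M.R) r :=
    fun r => by
      have := (((hasDerivAt_id r).const_sub M.R).fun_pow 2).hasDerivWithinAt (s := Icc 0 M.R)
      simpa using this
  -- At `t = ρ²`, with `ρ = R - r`, one has `h' = -(κ + 2tκ')` and `z' = -2ρζ'`.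
  have hunit : ∀ t ∈ Icc 0 (M.R ^ 2), (κ t + 2 * t * derivWithin κ (Icc 0 (M.R ^ 2)) t) ^ 2 +
      4 * t * derivWithin ζ (Icc 0 (M.R ^ 2)) t ^ 2 = 1 := fun t ht => by
    obtain ⟨hr, hrt, hrs⟩ := hroot t ht
    set r := M.R - Real.sqrt t with hrdef
    have hmr := hmaps hr
    have dκ := (hκ'.1 _ hmr).hasDerivWithinAt.comp r (hinner r) hmaps
    have dζ := (hζ'.1 _ hmr).hasDerivWithinAt.comp r (hinner r) hmaps
    have dh := (((hasDerivAt_id r).const_sub M.R).hasDerivWithinAt.mul dκ).congr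
      (fun s hs => (hp s hs).1) (hp r hr).1
    have dz := dζ.congr (fun s hs => (hp s hs).2) (hp r hr).2
    have h1 := M.unit_speed r hr
    rw [dh.derivWithin (huR r hr), dz.derivWithin (huR r hr)] at h1
    have hs := Real.sq_sqrt ht.1
    simp only [id, Function.comp, hrs, hs] at h1
    linear_combination h1 + (-4 * derivWithin κ (Icc 0 (M.R ^ 2)) t * κ t -
      4 * derivWithin ζ (Icc 0 (M.R ^ 2)) t ^ 2 - 4 * derivWithin κ (Icc 0 (M.R ^ 2)) t ^ 2 *
      (t + Real.sqrt t ^ 2)) * hs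
  have hκpos' : ∀ t ∈ Ioc 0 (M.R ^ 2), 0 < κ t := fun t ht => by
    obtain ⟨hr, hrt, hrs⟩ := hroot t ⟨ht.1.le, ht.2⟩
    have hs := Real.sqrt_pos.2 ht.1
    have h1 : 0 < M.h (M.R - Real.sqrt t) := by
      rcases eq_or_lt_of_le hr.1 with h | h
      · rw [← h, M.h_zero]; exact one_pos
      · exact M.h_pos _ ⟨h, by linarith⟩
    rw [(hp _ hr).1, hrs, Real.sq_sqrt ht.1.le] at h1
    exact pos_of_mul_pos_right h1 hs.le
  have hκ0 : κ 0 = 1 := by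
    have h1 := hunit 0 h0
    -- Unit speed only gives `κ 0 ^ 2 = 1`; the sign comes from the limit of `κ > 0` off the pole.
    have h2 : 0 ≤ κ 0 := by
      have hc : Tendsto κ (nhdsWithin 0 (Ioc 0 (M.R ^ 2))) (nhds (κ 0)) :=
        ((hκ.continuousOn 0 h0).mono Ioc_subset_Icc_self)
      have : (nhdsWithin (0 : ℝ) (Ioc 0 (M.R ^ 2))).NeBot := by
        rw [nhdsWithin_Ioc_eq_nhdsGT hR2]; infer_instance
      exact ge_of_tendsto hc (eventually_mem_nhdsWithin.mono fun t ht => (hκpos' t ht).le)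
    have h3 : κ 0 ^ 2 = 1 := by simpa using h1
    nlinarith
  have hκpos : ∀ t ∈ Icc 0 (M.R ^ 2), 0 < κ t := fun t ht => by
    rcases eq_or_lt_of_le ht.1 with rfl | h
    · rw [hκ0]; exact one_pos
    · exact hκpos' t ⟨h, ht.2⟩
  obtain ⟨k, hk, hk'⟩ := hκ.exists_eq_add_mul hR2 h0
  rw [hκ0] at hk'
  -- This is `(1 - κ) / (2tκ)` with the factor `t` cancelled through `κ = 1 + t k`. Normalising its
  -- antiderivative to vanish at `R²` later yields `R * Q (R²) = 1`.
  have hμ : ContDiffOn ℝ ∞ (fun t => -k t / (2 * κ t)) (Icc 0 (M.R ^ 2)) :=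
    hk.neg.div (contDiffOn_const.mul hκ) fun t ht => by have := hκpos t ht; positivity
  obtain ⟨w, hw, hw'⟩ := hμ.exists_antideriv hR2
  refine ⟨κ, ζ, fun t => M.R⁻¹ * Real.exp (w t - w (M.R ^ 2)), derivWithin κ (Icc 0 (M.R ^ 2)),
    derivWithin ζ (Icc 0 (M.R ^ 2)),
    fun t => M.R⁻¹ * (Real.exp (w t - w (M.R ^ 2)) * (-k t / (2 * κ t))), ?_⟩
  refine ⟨hκ, hκ'.2, hζ'.2, contDiffOn_const.mul (hw.sub contDiffOn_const).exp,
    fun t ht => (hκ'.1 t ht).hasDerivWithinAt, fun t ht => (hζ'.1 t ht).hasDerivWithinAt,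
    fun t ht => (((hw' t ht).sub_const _).exp).const_mul _, fun r hr => (hp r hr).1,
    fun r hr => (hp r hr).2, hκpos, fun t _ => by positivity, hunit, fun t ht => ?_, ?_⟩
  · have h1 := hκpos t ht
    have h2 := hk' t ht
    have h3 : 1 - κ t = -(t * k t) := by linarith
    rw [h3]
    field_simp
  · simp [hR.ne']

namespace IsRadialProfile

variable {M} {κ ζ Q κ' ζ' Q' : ℝ → ℝ} (hp : M.IsRadialProfile κ ζ Q κ' ζ' Q')
include hp

theorem κ_end : M.R * κ (M.R ^ 2) = 1 := by
  have := hp.h_eq 0 ⟨le_rfl, M.R_pos.le⟩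
  rw [M.h_zero, sub_zero] at this
  exact this.symm

theorem κ_mul_deriv {t : ℝ} (ht : t ∈ Icc 0 (M.R ^ 2)) : κ t * (Q t + 2 * t * Q' t) = Q t := by
  linear_combination hp.conformal t ht

theorem hasDerivWithinAt_mul_Q_sq {ρ : ℝ} (hρ : ρ ∈ Icc 0 M.R) :
    HasDerivWithinAt (fun ρ => ρ * Q (ρ ^ 2)) (Q (ρ ^ 2) / κ (ρ ^ 2)) (Icc 0 M.R) ρ := by
  have hmaps : MapsTo (fun ρ : ℝ => ρ ^ 2) (Icc 0 M.R) (Icc 0 (M.R ^ 2)) := fun r hr =>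
    ⟨sq_nonneg _, pow_le_pow_left₀ hr.1 hr.2 2⟩
  have h0 : HasDerivWithinAt (fun ρ : ℝ => ρ ^ 2) (2 * ρ) (Icc 0 M.R) ρ := by
    simpa using ((hasDerivAt_id' ρ).fun_pow 2).hasDerivWithinAt (s := Icc 0 M.R)
  have h1 : HasDerivWithinAt (fun ρ => Q (ρ ^ 2)) (Q' (ρ ^ 2) * (2 * ρ)) (Icc 0 M.R) ρ :=
    (hp.deriv_Q (ρ ^ 2) (hmaps hρ)).comp (h₂ := Q) (h := fun ρ : ℝ => ρ ^ 2) ρ h0 hmaps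
  refine ((hasDerivAt_id' ρ).hasDerivWithinAt.mul h1).congr_deriv ?_
  rw [eq_div_iff (hp.κ_pos _ (hmaps hρ)).ne']
  linear_combination hp.κ_mul_deriv (hmaps hρ)

theorem strictMonoOn : StrictMonoOn (fun ρ => ρ * Q (ρ ^ 2)) (Icc 0 M.R) := by
  refine strictMonoOn_of_deriv_pos (convex_Icc 0 M.R)
    (fun ρ hρ => (hp.hasDerivWithinAt_mul_Q_sq hρ).continuousWithinAt) fun ρ hρ => ?_
  rw [interior_Icc] at hρ
  have hm : ρ ^ 2 ∈ Icc 0 (M.R ^ 2) := ⟨sq_nonneg _, pow_le_pow_left₀ hρ.1.le hρ.2.le 2⟩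
  rw [((hp.hasDerivWithinAt_mul_Q_sq (Ioo_subset_Icc_self hρ)).hasDerivAt
    (Icc_mem_nhds hρ.1 hρ.2)).deriv]
  exact div_pos (hp.Q_pos _ hm) (hp.κ_pos _ hm)

theorem mul_Q_sq_pos {ρ : ℝ} (hρ : ρ ∈ Ioc 0 M.R) : 0 < ρ * Q (ρ ^ 2) :=
  mul_pos hρ.1 (hp.Q_pos _ ⟨sq_nonneg _, pow_le_pow_left₀ hρ.1.le hρ.2 2⟩)

/-- As `h = ρκ`, the function `-log (ρ Q(ρ²))` has derivative `1 / h` in `r`, and by the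
normalisation of `Q` it vanishes at `r = 0`; so it is `τ`. -/
theorem mul_Q_sq_eq_exp {r : ℝ} (hr : r ∈ Ico 0 M.R) :
    (M.R - r) * Q ((M.R - r) ^ 2) = Real.exp (-M.tau r) := by
  have hmem : ∀ s ∈ Icc 0 r, M.R - s ∈ Ioc 0 M.R := fun s hs =>
    ⟨by linarith [hs.2, hr.2], by linarith [hs.1]⟩
  have hmaps : MapsTo (fun s => M.R - s) (Icc 0 r) (Icc 0 M.R) := fun s hs =>
    Ioc_subset_Icc_self (hmem s hs)
  have hd : ∀ s ∈ Icc 0 r, HasDerivWithinAt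
      (fun s => -Real.log ((M.R - s) * Q ((M.R - s) ^ 2))) (1 / M.h s) (Icc 0 r) s := fun s hs => by
    have hsq : (M.R - s) ^ 2 ∈ Icc 0 (M.R ^ 2) :=
      ⟨sq_nonneg _, pow_le_pow_left₀ (hmem s hs).1.le (hmem s hs).2 2⟩
    have h1 := (hp.hasDerivWithinAt_mul_Q_sq (hmaps hs)).comp s
      ((hasDerivAt_id' s).const_sub M.R).hasDerivWithinAt hmaps
    refine (h1.log (hp.mul_Q_sq_pos (hmem s hs)).ne').neg.congr_deriv ?_
    rw [hp.h_eq s ⟨hs.1, hs.2.trans hr.2.le⟩]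
    have := (hp.κ_pos _ hsq).ne'
    have := (hp.Q_pos _ hsq).ne'
    have := (hmem s hs).1.ne'
    simp only [Function.comp]
    field_simp
  have hpos : ∀ s ∈ Icc 0 r, M.h s ≠ 0 := fun s hs => by
    rcases eq_or_lt_of_le hs.1 with h | h
    · rw [← h, M.h_zero]; exact one_ne_zero
    · exact (M.h_pos s ⟨h, hs.2.trans_lt hr.2⟩).ne'
  have hc : ContinuousOn (fun s => 1 / M.h s) (uIcc 0 r) := by
    rw [uIcc_of_le hr.1]
    exact continuousOn_const.div
      (M.h_smooth.continuousOn.mono (Icc_subset_Icc_right hr.2.le)) hpos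
  have h := intervalIntegral.integral_eq_sub_of_hasDerivAt_of_le hr.1
    (fun s hs => (hd s hs).continuousWithinAt)
    (fun s hs => (hd s (Ioo_subset_Icc_self hs)).hasDerivAt (Icc_mem_nhds hs.1 hs.2))
    hc.intervalIntegrable
  rw [tau, h, sub_zero, hp.Q_end, Real.log_one, neg_zero, sub_zero, neg_neg, Real.exp_log]
  exact hp.mul_Q_sq_pos (hmem r ⟨hr.1, le_rfl⟩)

end IsRadialProfile

end SurfaceOfRevolution

/-! ### The induced metric and the conformal chart in Cartesian coordinates -/

/-- The square of the Euclidean norm in coordinates. -/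
def sqNorm (x : Plane) : ℝ := x 0 ^ 2 + x 1 ^ 2

theorem sqNorm_eq (x : Plane) : sqNorm x = ‖x‖ ^ 2 := by
  rw [EuclideanSpace.norm_sq_eq, Fin.sum_univ_two]
  simp [sqNorm]

theorem hasFDerivAt_coord (x : Plane) (i : Fin 2) :
    HasFDerivAt (fun x : Plane => x i) (EuclideanSpace.proj i : Plane →L[ℝ] ℝ) x :=
  (EuclideanSpace.proj i : Plane →L[ℝ] ℝ).hasFDerivAt

theorem contDiff_coord (i : Fin 2) : ContDiff ℝ ∞ fun x : Plane => x i :=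
  (EuclideanSpace.proj i : Plane →L[ℝ] ℝ).contDiff

theorem contDiff_sqNorm : ContDiff ℝ ∞ sqNorm :=
  ((contDiff_coord 0).pow 2).add ((contDiff_coord 1).pow 2)

theorem hasFDerivAt_sqNorm (x : Plane) : HasFDerivAt sqNorm
    ((2 * x 0) • (EuclideanSpace.proj 0 : Plane →L[ℝ] ℝ) +
      (2 * x 1) • (EuclideanSpace.proj 1 : Plane →L[ℝ] ℝ)) x := by
  have := ((hasFDerivAt_coord x 0).pow 2).add ((hasFDerivAt_coord x 1).pow 2)
  refine HasFDerivAt.congr_fderiv (f := sqNorm) this ?_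
  simp

theorem mapsTo_sqNorm (R : ℝ) : MapsTo sqNorm (closedBall 0 R) (Icc 0 (R ^ 2)) := fun x hx => by
  rw [sqNorm_eq]
  exact ⟨sq_nonneg _, pow_le_pow_left₀ (norm_nonneg _) (mem_closedBall_zero_iff.1 hx) 2⟩

theorem hasFDerivWithinAt_comp_sqNorm {R : ℝ} {φ φ' : ℝ → ℝ}
    (h : ∀ t ∈ Icc 0 (R ^ 2), HasDerivWithinAt φ (φ' t) (Icc 0 (R ^ 2)) t) {x : Plane}
    (hx : x ∈ closedBall (0 : Plane) R) :
    HasFDerivWithinAt (fun x => φ (sqNorm x)) (φ' (sqNorm x) •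
      ((2 * x 0) • (EuclideanSpace.proj 0 : Plane →L[ℝ] ℝ) +
        (2 * x 1) • (EuclideanSpace.proj 1 : Plane →L[ℝ] ℝ))) (closedBall 0 R) x :=
  (h _ (mapsTo_sqNorm R hx)).comp_hasFDerivWithinAt x (hasFDerivAt_sqNorm x).hasFDerivWithinAt
    (mapsTo_sqNorm R)

namespace SurfaceOfRevolution

variable {M : SurfaceOfRevolution}

/-- The coefficient of `x xᵀ` in the metric `κ² + N x xᵀ`. -/
noncomputable def radialCoeff (κ κ' ζ' : ℝ → ℝ) (t : ℝ) : ℝ :=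
  4 * κ t * κ' t + 4 * t * κ' t ^ 2 + 4 * ζ' t ^ 2

/-- The chart of a surface of revolution with conformal factor `Q`. -/
noncomputable def radialChart (Q : ℝ → ℝ) (x : Plane) : ℂ :=
  ⟨Q (sqNorm x) * x 0, Q (sqNorm x) * x 1⟩

theorem radialChart_smul_unitVec (Q : ℝ → ℝ) (ρ θ : ℝ) :
    radialChart Q (ρ • unitVec θ) = (ρ * Q (ρ ^ 2) : ℝ) * Complex.exp (θ * Complex.I) := by
  have h : sqNorm (ρ • unitVec θ) = ρ ^ 2 := by
    rw [sqNorm_eq, norm_smul, norm_unitVec, mul_one, Real.norm_eq_abs, sq_abs]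
  rw [radialChart, h]
  apply Complex.ext
  · rw [Complex.re_ofReal_mul, Complex.exp_ofReal_mul_I_re]; simp [unitVec]; ring
  · rw [Complex.im_ofReal_mul, Complex.exp_ofReal_mul_I_im]; simp [unitVec]; ring

namespace IsRadialProfile

variable {κ ζ Q κ' ζ' Q' : ℝ → ℝ} (hp : M.IsRadialProfile κ ζ Q κ' ζ' Q')
include hp

theorem Φ_eq {x : Plane} (hx : x ∈ M.dom) :
    M.Φ x = !₂[κ (sqNorm x) * x 0, κ (sqNorm x) * x 1, ζ (sqNorm x)] := by
  obtain ⟨θ, hθ⟩ := exists_eq_norm_smul_unitVec x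
  have hn := mem_closedBall_zero_iff.1 hx
  have hr : M.R - ‖x‖ ∈ Icc 0 M.R := ⟨by linarith, by linarith [norm_nonneg x]⟩
  have h1 := M.param _ hr θ
  rw [hp.h_eq _ hr, hp.z_eq _ hr, sub_sub_cancel, ← hθ, ← sqNorm_eq] at h1
  have h2 : x 0 = ‖x‖ * Real.cos θ := by conv_lhs => rw [hθ]; simp [unitVec]
  have h3 : x 1 = ‖x‖ * Real.sin θ := by conv_lhs => rw [hθ]; simp [unitVec]
  rw [h1, h2, h3]
  ext i
  fin_cases i <;> simp <;> ring

theorem fderivWithin_Φ {x : Plane} (hx : x ∈ M.dom) (v : Plane) :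
    fderivWithin ℝ M.Φ M.dom x v =
      !₂[κ (sqNorm x) * v 0 + x 0 * (κ' (sqNorm x) * (2 * x 0 * v 0 + 2 * x 1 * v 1)),
        κ (sqNorm x) * v 1 + x 1 * (κ' (sqNorm x) * (2 * x 0 * v 0 + 2 * x 1 * v 1)),
        ζ' (sqNorm x) * (2 * x 0 * v 0 + 2 * x 1 * v 1)] := by
  have hu := DiskSurface.uniqueDiffOn_dom x hx
  have dκ := hasFDerivWithinAt_comp_sqNorm hp.deriv_κ hx
  have dζ := hasFDerivWithinAt_comp_sqNorm hp.deriv_ζ hx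
  have dΦ := (M.smooth.differentiableOn (by simp) x hx).hasFDerivWithinAt
  have hcomp : ∀ i : Fin 3, fderivWithin ℝ M.Φ M.dom x v i =
      fderivWithin ℝ (fun y => M.Φ y i) M.dom x v := fun i =>
    (congrArg (· v) (((EuclideanSpace.proj i : Space →L[ℝ] ℝ).hasFDerivAt.comp_hasFDerivWithinAt x
      dΦ).fderivWithin hu)).symm
  ext i
  rw [hcomp i]
  fin_cases i
  · have h := (dκ.mul (hasFDerivAt_coord x 0).hasFDerivWithinAt).congr (f₁ := fun y => M.Φ y 0)
      (fun y hy => by simp [hp.Φ_eq hy]) (by simp [hp.Φ_eq hx])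
    refine (congrArg (· v) (h.fderivWithin hu)).trans ?_
    simp
    ring
  · have h := (dκ.mul (hasFDerivAt_coord x 1).hasFDerivWithinAt).congr (f₁ := fun y => M.Φ y 1)
      (fun y hy => by simp [hp.Φ_eq hy]) (by simp [hp.Φ_eq hx])
    refine (congrArg (· v) (h.fderivWithin hu)).trans ?_
    simp
    ring
  · have h := dζ.congr (f₁ := fun y => M.Φ y 2)
      (fun y hy => by simp [hp.Φ_eq hy]) (by simp [hp.Φ_eq hx])
    refine (congrArg (· v) (h.fderivWithin hu)).trans ?_
    simp
    ring

/-- Unit speed again: the metric `κ² + N x xᵀ` has eigenvalue `κ² + tN = 1` in the radial direction,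
and `κ²` in the angular one. -/
theorem mul_radialCoeff {t : ℝ} (ht : t ∈ Icc 0 (M.R ^ 2)) :
    t * radialCoeff κ κ' ζ' t = 1 - κ t ^ 2 := by
  rw [radialCoeff]
  linear_combination hp.unit_speed t ht

theorem metric_eq {x : Plane} (hx : x ∈ M.dom) : M.metric x =
    !![κ (sqNorm x) ^ 2 + radialCoeff κ κ' ζ' (sqNorm x) * x 0 ^ 2,
      radialCoeff κ κ' ζ' (sqNorm x) * (x 0 * x 1);
      radialCoeff κ κ' ζ' (sqNorm x) * (x 0 * x 1),
      κ (sqNorm x) ^ 2 + radialCoeff κ κ' ζ' (sqNorm x) * x 1 ^ 2] := by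
  have hs : sqNorm x = x 0 ^ 2 + x 1 ^ 2 := rfl
  ext i j
  simp only [DiskSurface.metric, Matrix.of_apply, hp.fderivWithin_Φ hx, radialCoeff]
  set a := κ (sqNorm x)
  set b := κ' (sqNorm x)
  set d := ζ' (sqNorm x)
  rw [hs, PiLp.inner_apply, Fin.sum_univ_three]
  fin_cases i <;> fin_cases j <;> simp [mul_pow] <;> ring

theorem det_metric {x : Plane} (hx : x ∈ M.dom) : (M.metric x).det = κ (sqNorm x) ^ 2 := by
  rw [hp.metric_eq hx, Matrix.det_fin_two_of]
  have h := hp.mul_radialCoeff (mapsTo_sqNorm _ hx)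
  have hs : sqNorm x = x 0 ^ 2 + x 1 ^ 2 := rfl
  set N := radialCoeff κ κ' ζ' (sqNorm x)
  have h' : (x 0 ^ 2 + x 1 ^ 2) * N = 1 - κ (sqNorm x) ^ 2 := by rw [← hs, h]
  linear_combination κ (sqNorm x) ^ 2 * h'

theorem κ_pos' {x : Plane} (hx : x ∈ M.dom) : 0 < κ (sqNorm x) := hp.κ_pos _ (mapsTo_sqNorm _ hx)

theorem conductivity_eq {x : Plane} (hx : x ∈ M.dom) (i j : Fin 2) : M.conductivity i j x =
    (κ (sqNorm x))⁻¹ *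
    !![κ (sqNorm x) ^ 2 + radialCoeff κ κ' ζ' (sqNorm x) * x 1 ^ 2,
      -(radialCoeff κ κ' ζ' (sqNorm x) * (x 0 * x 1));
      -(radialCoeff κ κ' ζ' (sqNorm x) * (x 0 * x 1)),
      κ (sqNorm x) ^ 2 + radialCoeff κ κ' ζ' (sqNorm x) * x 0 ^ 2] i j := by
  have hk := hp.κ_pos' hx
  rw [DiskSurface.conductivity, hp.det_metric hx, Real.sqrt_sq hk.le, Matrix.inv_def,
    hp.det_metric hx, hp.metric_eq hx, Matrix.adjugate_fin_two_of, Ring.inverse_eq_inv',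
    Matrix.smul_apply, smul_eq_mul, ← mul_assoc]
  congr 1
  field_simp

theorem metric_inv_mulVec {x : Plane} (hx : x ∈ M.dom) :
    ((M.metric x)⁻¹.mulVec fun i => x i) = fun i => x i := by
  have h := hp.mul_radialCoeff (mapsTo_sqNorm _ hx)
  have hs : sqNorm x = x 0 ^ 2 + x 1 ^ 2 := rfl
  have hk := hp.κ_pos' hx
  have h1 : ((M.metric x).mulVec fun i => x i) = fun i => x i := by
    rw [hp.metric_eq hx]
    set N := radialCoeff κ κ' ζ' (sqNorm x)
    have h' : (x 0 ^ 2 + x 1 ^ 2) * N = 1 - κ (sqNorm x) ^ 2 := by rw [← hs, h]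
    ext i
    fin_cases i
    · simp [Matrix.mulVec, dotProduct, Fin.sum_univ_two]
      linear_combination x 0 * h'
    · simp [Matrix.mulVec, dotProduct, Fin.sum_univ_two]
      linear_combination x 1 * h'
  conv_lhs => rw [← h1]
  rw [Matrix.mulVec_mulVec, Matrix.nonsing_inv_mul, Matrix.one_mulVec]
  rw [hp.det_metric hx]
  exact (isUnit_iff_ne_zero.2 (by positivity))

theorem outwardNormal_eq (θ : ℝ) : M.outwardNormal (M.R • unitVec θ) = unitVec θ := by
  have hR := M.R_pos
  rw [DiskSurface.outwardNormal, hp.metric_inv_mulVec (DiskSurface.smul_unitVec_mem_dom θ)]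
  have h : ((fun i => (M.R • unitVec θ) i) ⬝ᵥ fun i => (M.R • unitVec θ) i) = M.R ^ 2 := by
    have := Real.cos_sq_add_sin_sq θ
    simp [dotProduct, unitVec, Fin.sum_univ_two]
    linear_combination M.R ^ 2 * this
  rw [h, Real.sqrt_sq hR.le]
  ext i
  simp [hR.ne']

theorem contDiffOn_radialChart : ContDiffOn ℝ ∞ (radialChart Q) M.dom := by
  have hQ : ContDiffOn ℝ ∞ (fun x => Q (sqNorm x)) M.dom :=
    hp.smooth_Q.comp contDiff_sqNorm.contDiffOn (mapsTo_sqNorm _)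
  have h1 : ∀ i, ContDiffOn ℝ ∞ (fun x => ((Q (sqNorm x) * x i : ℝ) : ℂ)) M.dom := fun i =>
    Complex.ofRealCLM.contDiff.comp_contDiffOn (hQ.mul (contDiff_coord i).contDiffOn)
  refine ((h1 0).add ((h1 1).mul (contDiffOn_const (c := Complex.I)))).congr fun x _ => ?_
  simp [radialChart, Complex.ext_iff]

theorem fderivWithin_radialChart {x : Plane} (hx : x ∈ M.dom) (v : Plane) :
    fderivWithin ℝ (radialChart Q) M.dom x v =
      ⟨Q (sqNorm x) * v 0 + x 0 * (Q' (sqNorm x) * (2 * x 0 * v 0 + 2 * x 1 * v 1)),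
        Q (sqNorm x) * v 1 + x 1 * (Q' (sqNorm x) * (2 * x 0 * v 0 + 2 * x 1 * v 1))⟩ := by
  have hu := DiskSurface.uniqueDiffOn_dom x hx
  have dQ := hasFDerivWithinAt_comp_sqNorm hp.deriv_Q hx
  have dF := (hp.contDiffOn_radialChart.differentiableOn (by simp) x hx).hasFDerivWithinAt
  have e0 := congrArg (· v) ((Complex.reCLM.hasFDerivAt.comp_hasFDerivWithinAt x dF).fderivWithin hu)
  have e1 := congrArg (· v) ((Complex.imCLM.hasFDerivAt.comp_hasFDerivWithinAt x dF).fderivWithin hu)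
  have h0 := congrArg (· v)
    ((dQ.mul (hasFDerivAt_coord x 0).hasFDerivWithinAt).fderivWithin hu)
  have h1 := congrArg (· v)
    ((dQ.mul (hasFDerivAt_coord x 1).hasFDerivWithinAt).fderivWithin hu)
  apply Complex.ext
  · refine (e0.symm.trans h0).trans ?_
    simp
    ring
  · refine (e1.symm.trans h1).trans ?_
    simp
    ring

/-- Radial and angular unit coordinate vectors have lengths `1` and `κ` on the surface, while the
differential of the chart stretches them by `Q + 2tQ' = Q / κ` and by `Q`. Both ratios are `Q / κ`,
so the chart is conformal; at the boundary `Q = κ = 1 / R` and the factor is one. -/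
theorem isConformalChart : M.IsConformalChart (radialChart Q) := by
  have hsub : ball (0 : Plane) M.R ⊆ M.dom := ball_subset_closedBall
  have hfd : ∀ x ∈ ball (0 : Plane) M.R, ∀ v, fderiv ℝ (radialChart Q) x v =
      ⟨Q (sqNorm x) * v 0 + x 0 * (Q' (sqNorm x) * (2 * x 0 * v 0 + 2 * x 1 * v 1)),
        Q (sqNorm x) * v 1 + x 1 * (Q' (sqNorm x) * (2 * x 0 * v 0 + 2 * x 1 * v 1))⟩ :=
    fun x hx v => by
      rw [← hp.fderivWithin_radialChart (hsub hx), fderivWithin_of_mem_nhds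
        (DiskSurface.dom_mem_nhds hx)]
  have hnorm : ∀ x : Plane, ∃ θ : ℝ, x = ‖x‖ • unitVec θ := exists_eq_norm_smul_unitVec
  have hmap : ∀ x ∈ M.dom, ‖radialChart Q x‖ = ‖x‖ * Q (‖x‖ ^ 2) := fun x hx => by
    obtain ⟨θ, hθ⟩ := hnorm x
    have h := radialChart_smul_unitVec Q ‖x‖ θ
    rw [← hθ] at h
    rw [h, norm_mul, Complex.norm_exp_ofReal_mul_I, mul_one, Complex.norm_real, Real.norm_of_nonneg]
    refine mul_nonneg (norm_nonneg _) (hp.Q_pos _ ?_).le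
    rw [← sqNorm_eq]
    exact mapsTo_sqNorm _ hx
  have hRm : M.R ∈ Icc 0 M.R := ⟨M.R_pos.le, le_rfl⟩
  -- Off the pole `N Q = 2κQ'(1 + κ)`: multiplied by `t`, both sides equal `(1 - κ²) Q`. At the pole
  -- the factor `x i * x j` makes both sides zero, so no limit is needed.
  have hkey : ∀ x ∈ ball (0 : Plane) M.R, ∀ i j,
      x i * x j * (radialCoeff κ κ' ζ' (sqNorm x) * Q (sqNorm x)) =
        x i * x j * (2 * κ (sqNorm x) * Q' (sqNorm x) + 2 * κ (sqNorm x) ^ 2 * Q' (sqNorm x)) :=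
    fun x hx i j => by
      have hm := mapsTo_sqNorm _ (hsub hx)
      rcases eq_or_ne (sqNorm x) 0 with h | h
      · have h0 : x = 0 := by
          rw [sqNorm_eq] at h
          exact norm_eq_zero.1 (pow_eq_zero_iff two_ne_zero |>.1 h)
        simp [h0]
      · congr 1
        refine mul_left_cancel₀ h ?_
        linear_combination Q (sqNorm x) * hp.mul_radialCoeff hm -
          (1 + κ (sqNorm x)) * hp.conformal _ hm
  have hsm : ∀ φ : ℝ → ℝ, ContDiffOn ℝ ∞ φ (Icc 0 (M.R ^ 2)) →
      ContDiffOn ℝ ∞ (fun x => φ (sqNorm x)) M.dom := fun φ hφ =>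
    hφ.comp contDiff_sqNorm.contDiffOn (mapsTo_sqNorm _)
  have hN : ContDiffOn ℝ ∞ (fun x => radialCoeff κ κ' ζ' (sqNorm x)) M.dom := by
    have h1 := hsm _ hp.smooth_κ
    have h2 := hsm _ hp.smooth_κ'
    have h3 := hsm _ hp.smooth_ζ'
    exact (((contDiffOn_const.mul h1).mul h2).add
      ((contDiffOn_const.mul contDiff_sqNorm.contDiffOn).mul (h2.pow 2))).add
      (contDiffOn_const.mul (h3.pow 2))
  constructor
  · exact hp.contDiffOn_radialChart
  · intro x hx
    rw [mem_closedBall_zero_iff, hmap x hx, ← hp.Q_end]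
    have hn := mem_closedBall_zero_iff.1 hx
    exact hp.strictMonoOn.monotoneOn ⟨norm_nonneg x, hn⟩ hRm hn
  · intro x hx
    rw [mem_ball_zero_iff, hmap x (hsub hx), ← hp.Q_end]
    have hn := mem_ball_zero_iff.1 hx
    exact hp.strictMonoOn ⟨norm_nonneg x, hn.le⟩ hRm hn
  · intro θ
    rw [radialChart_smul_unitVec, hp.Q_end, Complex.ofReal_one, one_mul]
  · intro θ
    have hsq : sqNorm (M.R • unitVec θ) = M.R ^ 2 := by
      rw [sqNorm_eq, norm_smul, norm_unitVec, mul_one, Real.norm_eq_abs, sq_abs]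
    have h1 := hp.κ_mul_deriv (t := M.R ^ 2) ⟨sq_nonneg _, le_rfl⟩
    have h2 := hp.κ_end
    have h3 := hp.Q_end
    -- The radial stretch at the boundary: `κ (Q + 2tQ') = Q` at `t = R²`, where `R κ = R Q = 1`.
    have h4 : Q (M.R ^ 2) + 2 * M.R ^ 2 * Q' (M.R ^ 2) = 1 := by
      linear_combination M.R * h1 + h3 - (Q (M.R ^ 2) + 2 * M.R ^ 2 * Q' (M.R ^ 2)) * h2
    have h5 := Real.cos_sq_add_sin_sq θ
    rw [hp.fderivWithin_radialChart (DiskSurface.smul_unitVec_mem_dom θ), hsq]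
    apply Complex.ext
    · rw [Complex.exp_ofReal_mul_I_re]
      simp [unitVec]
      linear_combination Real.cos θ * h4 + 2 * M.R ^ 2 * Q' (M.R ^ 2) * Real.cos θ * h5
    · rw [Complex.exp_ofReal_mul_I_im]
      simp [unitVec]
      linear_combination Real.sin θ * h4 + 2 * M.R ^ 2 * Q' (M.R ^ 2) * Real.sin θ * h5
  · exact hp.outwardNormal_eq
  · intro x hx
    rw [hp.det_metric (hsub hx)]
    have := hp.κ_pos' (hsub hx)
    positivity
  · intro x hx i j
    have hinv : ContDiffOn ℝ ∞ (fun x => (κ (sqNorm x))⁻¹) M.dom :=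
      (hsm _ hp.smooth_κ).inv fun y hy => (hp.κ_pos' hy).ne'
    have hκ2 := (hsm _ hp.smooth_κ).pow 2
    have c0 : ContDiffOn ℝ ∞ (fun x : Plane => x 0) M.dom := (contDiff_coord 0).contDiffOn
    have c1 : ContDiffOn ℝ ∞ (fun x : Plane => x 1) M.dom := (contDiff_coord 1).contDiffOn
    have : ContDiffOn ℝ ∞ (M.conductivity i j) M.dom := by
      refine ContDiffOn.congr (f := fun x => (κ (sqNorm x))⁻¹ * _) ?_
        fun y hy => hp.conductivity_eq hy i j
      refine hinv.mul ?_
      fin_cases i <;> fin_cases j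
      · exact hκ2.add (hN.mul (c1.pow 2))
      · exact (hN.mul (c0.mul c1)).neg
      · exact (hN.mul (c0.mul c1)).neg
      · exact hκ2.add (hN.mul (c0.pow 2))
    exact (this.contDiffAt (DiskSurface.dom_mem_nhds hx)).differentiableAt (by simp)
  · intro x hx
    rw [hp.conductivity_eq (hsub hx), hp.conductivity_eq (hsub hx)]
    simp
  · intro x hx
    have hk := hp.κ_pos' (hsub hx)
    have h := hp.mul_radialCoeff (mapsTo_sqNorm _ (hsub hx))
    have hs : sqNorm x = x 0 ^ 2 + x 1 ^ 2 := rfl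
    rw [hp.conductivity_eq (hsub hx)]
    set N := radialCoeff κ κ' ζ' (sqNorm x)
    have h' : (x 0 ^ 2 + x 1 ^ 2) * N = 1 - κ (sqNorm x) ^ 2 := by rw [← hs, h]
    refine mul_pos (inv_pos.2 hk) ?_
    simp only [Matrix.of_apply, Matrix.cons_val', Matrix.cons_val_zero]
    -- For negative `N` the quantity is rewritten as `κ² + N x₁² = 1 - N x₀²`, which is positive.
    rcases le_or_gt 0 N with hN0 | hN0
    · positivity
    · nlinarith [mul_nonneg (sq_nonneg (x 0)) (neg_nonneg.2 hN0.le)]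
  · intro x hx
    have hk := (hp.κ_pos' (hsub hx)).ne'
    have h := hp.mul_radialCoeff (mapsTo_sqNorm _ (hsub hx))
    have hs : sqNorm x = x 0 ^ 2 + x 1 ^ 2 := rfl
    rw [hp.conductivity_eq (hsub hx), hp.conductivity_eq (hsub hx), hp.conductivity_eq (hsub hx)]
    set N := radialCoeff κ κ' ζ' (sqNorm x)
    have h' : (x 0 ^ 2 + x 1 ^ 2) * N = 1 - κ (sqNorm x) ^ 2 := by rw [← hs, h]
    simp
    field_simp
    linear_combination κ (sqNorm x) ^ 2 * h'
  · intro x hx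
    have hk := (hp.κ_pos' (hsub hx)).ne'
    have hc := hp.conformal _ (mapsTo_sqNorm _ (hsub hx))
    have hs : sqNorm x = x 0 ^ 2 + x 1 ^ 2 := rfl
    have hk' := hkey x hx
    rw [Fin.sum_univ_two, hp.conductivity_eq (hsub hx), hp.conductivity_eq (hsub hx),
      hfd x hx, hfd x hx]
    generalize radialCoeff κ κ' ζ' (sqNorm x) = N at *
    generalize κ (sqNorm x) = a at *
    generalize Q (sqNorm x) = q at *
    generalize Q' (sqNorm x) = q' at *
    apply Complex.ext
    · simp [sq]
      field_simp
      linear_combination hk' 1 1 + a * hc - 2 * a ^ 2 * q' * hs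
    · simp [sq]
      field_simp
      linear_combination -hk' 0 1
  · intro x hx
    have hk := (hp.κ_pos' (hsub hx)).ne'
    have hc := hp.conformal _ (mapsTo_sqNorm _ (hsub hx))
    have hs : sqNorm x = x 0 ^ 2 + x 1 ^ 2 := rfl
    have hk' := hkey x hx
    rw [Fin.sum_univ_two, hp.conductivity_eq (hsub hx), hp.conductivity_eq (hsub hx),
      hfd x hx, hfd x hx]
    generalize radialCoeff κ κ' ζ' (sqNorm x) = N at *
    generalize κ (sqNorm x) = a at *
    generalize Q (sqNorm x) = q at *
    generalize Q' (sqNorm x) = q' at *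
    apply Complex.ext
    · simp [sq]
      field_simp
      linear_combination -hk' 0 1
    · simp [sq]
      field_simp
      linear_combination hk' 0 0 + a * hc - 2 * a ^ 2 * q' * hs
  · intro x hx
    have hm := mapsTo_sqNorm _ (hsub hx)
    have hs : sqNorm x = x 0 ^ 2 + x 1 ^ 2 := rfl
    -- The Jacobian is the product of the angular stretch `Q` and the radial stretch `Q + 2tQ'`,
    -- positive because `κ` times the latter is `Q`.
    have hpos : 0 < Q (sqNorm x) * (Q (sqNorm x) + 2 * sqNorm x * Q' (sqNorm x)) := by
      refine mul_pos (hp.Q_pos _ hm) ?_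
      refine pos_of_mul_pos_right (a := κ (sqNorm x)) ?_ (hp.κ_pos _ hm).le
      rw [hp.κ_mul_deriv hm]
      exact hp.Q_pos _ hm
    rw [hfd x hx, hfd x hx]
    refine hpos.trans_eq ?_
    simp
    linear_combination 2 * Q (sqNorm x) * Q' (sqNorm x) * hs

end IsRadialProfile

end SurfaceOfRevolution

/-! ### The flat disk, separated harmonic functions and the radial equation -/

/-- The flat unit disk as a surface of revolution. -/
noncomputable def unitDiskRevolution : SurfaceOfRevolution where
  toDiskSurface := unitDisk
  h r := 1 - r
  z _ := 0
  h_smooth := contDiffOn_const.sub contDiffOn_id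
  z_smooth := contDiffOn_const
  h_zero := sub_zero 1
  z_zero := rfl
  h_pos r hr := sub_pos.2 hr.2
  h_end := sub_self 1
  unit_speed r hr := by
    have hu : UniqueDiffWithinAt ℝ (Icc (0 : ℝ) unitDisk.R) r :=
      uniqueDiffOn_Icc unitDisk.R_pos r hr
    have h1 := ((hasDerivAt_id' r).const_sub 1).hasDerivWithinAt (s := Icc 0 unitDisk.R)
    rw [h1.derivWithin hu]
    simp
  param r _ θ := by
    ext i
    fin_cases i <;> simp [unitDisk, planeIncl, unitVec]

/-- Treats cosine and sine at once, through `η = 1` or `η = -i`. The angle `θ₀` serves to recover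
the radial factor from the product. -/
theorem exists_re_mul_pow_eq {T : ℝ → ℝ} {n : ℕ} (hT : T = Real.cos ∨ (T = Real.sin ∧ 1 ≤ n)) :
    (∃ η : ℂ, ∀ ρ θ : ℝ, (η * ((ρ : ℂ) * Complex.exp (θ * Complex.I)) ^ n).re =
      ρ ^ n * T (n * θ)) ∧ ∃ θ₀ : ℝ, T (n * θ₀) = 1 := by
  have h : ∀ ρ θ : ℝ, ((ρ : ℂ) * Complex.exp (θ * Complex.I)) ^ n =
      ((ρ ^ n : ℝ) : ℂ) * Complex.exp ((n * θ : ℝ) * Complex.I) := fun ρ θ => by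
    rw [mul_pow, ← Complex.exp_nat_mul]
    push_cast
    ring_nf
  rcases hT with rfl | ⟨rfl, hn⟩
  · refine ⟨⟨1, fun ρ θ => ?_⟩, 0, by simp⟩
    rw [h, one_mul, Complex.re_ofReal_mul, Complex.exp_ofReal_mul_I_re]
  · refine ⟨⟨-Complex.I, fun ρ θ => ?_⟩, Real.pi / 2 / n, ?_⟩
    · rw [h, ← Complex.exp_ofReal_mul_I_im, ← Complex.im_ofReal_mul]
      simp
    · rw [mul_div_cancel₀ _ (Nat.cast_ne_zero.2 (by omega : n ≠ 0)), Real.sin_pi_div_two]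

namespace SurfaceOfRevolution

namespace IsRadialProfile

variable {M : SurfaceOfRevolution} {κ ζ Q κ' ζ' Q' : ℝ → ℝ} (hp : M.IsRadialProfile κ ζ Q κ' ζ' Q')
include hp

/-- `E` is the modulus of the chart as a function of `r`, that is `e^(-τ)` continued by `0` to the
pole, where the integral `τ` diverges. -/
theorem exists_decay : ∃ E : ℝ → ℝ, ContinuousOn E (Icc 0 M.R) ∧ E 0 = 1 ∧ E M.R = 0 ∧
    (∀ r ∈ Ico 0 M.R, 0 < E r ∧ E r = Real.exp (-M.tau r)) ∧
    (∀ r ∈ Ioo 0 M.R, HasDerivAt E (-(E r / M.h r)) r) ∧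
    ∀ r θ : ℝ, radialChart Q ((M.R - r) • unitVec θ) = (E r : ℂ) * Complex.exp (θ * Complex.I) := by
  have hmaps : MapsTo (fun r => M.R - r) (Icc 0 M.R) (Icc 0 M.R) := fun r hr =>
    ⟨by linarith [hr.2], by linarith [hr.1]⟩
  have hd : ∀ r ∈ Icc 0 M.R, HasDerivWithinAt (fun r => (M.R - r) * Q ((M.R - r) ^ 2))
      (Q ((M.R - r) ^ 2) / κ ((M.R - r) ^ 2) * (-1)) (Icc 0 M.R) r := fun r hr =>
    (hp.hasDerivWithinAt_mul_Q_sq (hmaps hr)).comp r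
      ((hasDerivAt_id' r).const_sub M.R).hasDerivWithinAt hmaps
  refine ⟨fun r => (M.R - r) * Q ((M.R - r) ^ 2), fun r hr => (hd r hr).continuousWithinAt,
    by simp [hp.Q_end], by simp, fun r hr => ⟨?_, hp.mul_Q_sq_eq_exp hr⟩, fun r hr => ?_,
    fun r θ => radialChart_smul_unitVec Q _ θ⟩
  · exact hp.mul_Q_sq_pos ⟨by linarith [hr.2], by linarith [hr.1]⟩
  · refine ((hd r (Ioo_subset_Icc_self hr)).hasDerivAt (Icc_mem_nhds hr.1 hr.2)).congr_deriv ?_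
    have h0 : M.R - r ≠ 0 := by linarith [hr.2]
    have hk := (hp.κ_pos ((M.R - r) ^ 2)
      ⟨sq_nonneg _, pow_le_pow_left₀ (hmaps (Ioo_subset_Icc_self hr)).1
        (hmaps (Ioo_subset_Icc_self hr)).2 2⟩).ne'
    rw [hp.h_eq r (Ioo_subset_Icc_self hr)]
    field_simp

/-- The separated harmonic functions on a surface of revolution. -/
theorem isHarmonic_iff {n : ℕ} {T : ℝ → ℝ} (hT : T = Real.cos ∨ (T = Real.sin ∧ 1 ≤ n))
    {a : ℝ → ℝ} {f : Plane → ℝ} (hf : ContinuousOn f M.dom)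
    (hfa : ∀ r ∈ Icc 0 M.R, ∀ θ : ℝ, f ((M.R - r) • unitVec θ) = a r * T (n * θ)) :
    (M.IsHarmonic f ↔ ∃ c : ℝ, ∀ r ∈ Ico 0 M.R, a r = c * Real.exp (-(n * M.tau r))) ∧
      (M.IsHarmonic f → ∀ θ : ℝ,
        M.normalDeriv f (M.R • unitVec θ) = n * f (M.R • unitVec θ)) := by
  have hF := hp.isConformalChart
  obtain ⟨⟨η, hη⟩, θ₀, hθ₀⟩ := exists_re_mul_pow_eq hT
  obtain ⟨E, -, hE0, -, hE, -, hchart⟩ := hp.exists_decay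
  have hexp : ∀ r ∈ Ico 0 M.R, Real.exp (-(n * M.tau r)) = E r ^ n := fun r hr => by
    rw [(hE r hr).2, ← Real.exp_nat_mul, mul_neg]
  have hg : ∀ c r θ : ℝ, (diskSeries (Pi.single n (c * η))
      (radialChart Q ((M.R - r) • unitVec θ))).re = c * (E r ^ n * T (n * θ)) := fun c r θ => by
    rw [diskSeries_single, hchart, mul_assoc, Complex.re_ofReal_mul, hη]
  have hharm : ∀ c : ℝ, M.IsHarmonic fun x => (diskSeries (Pi.single n (c * η))
      (radialChart Q x)).re := fun c => hF.isHarmonic_re (.single _ _)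
  have hbd : ∀ θ : ℝ, f (M.R • unitVec θ) = a 0 * T (n * θ) := fun θ => by
    simpa using hfa 0 ⟨le_rfl, M.R_pos.le⟩ θ
  have hfwd : M.IsHarmonic f → EqOn f (fun x => (diskSeries (Pi.single n (a 0 * η))
      (radialChart Q x)).re) M.dom := fun h =>
    hF.eqOn_of_isHarmonic h (hharm _) fun θ => by
      have := hg (a 0) 0 θ
      rw [sub_zero, hE0, one_pow, one_mul] at this
      rw [this, hbd]
  refine ⟨⟨fun h => ⟨a 0, fun r hr => ?_⟩, ?_⟩, fun h θ => ?_⟩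
  · have hm : (M.R - r) • unitVec θ₀ ∈ M.dom := by
      rw [DiskSurface.dom, mem_closedBall_zero_iff, norm_smul, norm_unitVec, mul_one,
        Real.norm_of_nonneg (by linarith [hr.2])]
      linarith [hr.1]
    have h1 := hfwd h hm
    simp only [hg, hfa r (Ico_subset_Icc_self hr), hθ₀, mul_one] at h1
    rw [h1, hexp r hr]
  · rintro ⟨c, hc⟩
    refine (hharm c).congr ?_
    have hEq : EqOn f (fun x => (diskSeries (Pi.single n (c * η)) (radialChart Q x)).re)
        (M.dom ∩ {0}ᶜ) := fun x hx => by
      obtain ⟨θ, hθ⟩ := exists_eq_norm_smul_unitVec x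
      have hn := mem_closedBall_zero_iff.1 hx.1
      have hx0 : 0 < ‖x‖ := norm_pos_iff.2 hx.2
      have hr : M.R - ‖x‖ ∈ Ico 0 M.R := ⟨by linarith, by linarith⟩
      have h1 := hfa _ (Ico_subset_Icc_self hr) θ
      have h2 := hg c (M.R - ‖x‖) θ
      rw [sub_sub_cancel, ← hθ] at h1 h2
      simp only [h1, h2, hc _ hr, hexp _ hr, mul_assoc]
    -- The hypothesis does not constrain `a` at the pole; there the two functions agree by
    -- continuity, the pole being a limit of other points of the disk.
    refine hEq.of_subset_closure hf (hharm c).1.continuousOn inter_subset_left fun x hx => ?_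
    rcases eq_or_ne x 0 with rfl | h0
    · exact closure_mono (inter_subset_inter_left _ ball_subset_closedBall)
        ((dense_compl_singleton (0 : Plane)).open_subset_closure_inter isOpen_ball
          (mem_ball_self M.R_pos))
    · exact subset_closure ⟨hx, h0⟩
  · have hm := DiskSurface.smul_unitVec_mem_dom (S := M.toDiskSurface) θ
    have hs : (fun m : ℕ => (m : ℂ) * (Pi.single n (a 0 * η) : ℕ → ℂ) m) =
        Pi.single n (n * (a 0 * η)) := by
      ext m
      rcases eq_or_ne m n with rfl | h
      · simp
      · simp [h]
    rw [DiskSurface.normalDeriv_congr (hfwd h) hm, hF.normalDeriv_re (.single _ _), hfwd h hm, hs]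
    simp only [diskSeries_single, hF.boundary]
    rw [← Complex.ofReal_natCast, mul_assoc, Complex.re_ofReal_mul]

/-- The radial boundary value problem has exactly one solution. -/
theorem isRadialSolution_iff {n : ℕ} (hn : 1 ≤ n) (c : ℝ) (a : ℝ → ℝ) :
    M.IsRadialSolution n c a ↔
      (∀ r ∈ Ico 0 M.R, a r = c * Real.exp (-(n * M.tau r))) ∧ a M.R = 0 := by
  obtain ⟨E, hEc, hE0, hER, hE, hEd, -⟩ := hp.exists_decay
  have hR := M.R_pos
  have hn0 : n ≠ 0 := by omega
  have hexp : ∀ r ∈ Ico 0 M.R, Real.exp (-(n * M.tau r)) = E r ^ n := fun r hr => by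
    rw [(hE r hr).2, ← Real.exp_nat_mul, mul_neg]
  have hEn : ∀ r ∈ Ioo 0 M.R, HasDerivAt (fun r => E r ^ n) (-(n * E r ^ n / M.h r)) r :=
    fun r hr => by
      refine ((hEd r hr).fun_pow n).congr_deriv ?_
      obtain ⟨m, rfl⟩ := Nat.exists_eq_succ_of_ne_zero hn0
      simp only [Nat.succ_eq_add_one, Nat.add_sub_cancel]
      ring
  constructor
  · rintro ⟨hac, hode, ha0, haR⟩
    refine ⟨?_, haR⟩
    have hda : ∀ r ∈ Ioo 0 M.R, HasDerivAt a (deriv a r) r := fun r hr => (hode r hr).1.hasDerivAt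
    have hdd : ∀ r ∈ Ioo 0 M.R, HasDerivAt (fun s => M.h s * deriv a s)
        ((n : ℝ) ^ 2 * (M.h r)⁻¹ * a r) r := fun r hr => by
      have := (hode r hr).2.1.hasDerivAt
      rwa [sub_eq_zero.1 (hode r hr).2.2] at this
    have hh : ∀ r ∈ Ioo 0 M.R, M.h r ≠ 0 := fun r hr => (M.h_pos r hr).ne'
    have hEp : ∀ r ∈ Ioo 0 M.R, E r ^ n ≠ 0 := fun r hr =>
      (pow_pos (hE r (Ioo_subset_Ico_self hr)).1 n).ne'
    -- The equation factors as `(h d/dr - n)(h d/dr + n) a = 0`, and `h E' = -E`. Multiplying `h a'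
    -- + n a` by `Eⁿ`, and dividing `h a' - n a` by it, gives two first integrals.
    have h1 : ∀ r ∈ Ioo 0 M.R, HasDerivAt
        (fun s => (M.h s * deriv a s + n * a s) * E s ^ n) 0 r := fun r hr => by
      refine (((hdd r hr).add ((hda r hr).const_mul (n : ℝ))).mul (hEn r hr)).congr_deriv ?_
      have := hh r hr
      simp only [Pi.add_apply]
      field_simp
      ring
    have h2 : ∀ r ∈ Ioo 0 M.R, HasDerivAt
        (fun s => (M.h s * deriv a s - n * a s) / E s ^ n) 0 r := fun r hr => by
      refine (((hdd r hr).sub ((hda r hr).const_mul (n : ℝ))).div (hEn r hr)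
        (hEp r hr)).congr_deriv ?_
      have := hh r hr
      have := hEp r hr
      simp only [Pi.sub_apply]
      field_simp
      ring
    have hmid : M.R / 2 ∈ Ioo 0 M.R := ⟨by linarith, by linarith⟩
    have hconst : ∀ g : ℝ → ℝ, (∀ r ∈ Ioo 0 M.R, HasDerivAt g 0 r) →
        ∀ r ∈ Ioo 0 M.R, g r = g (M.R / 2) := fun g hg r hr =>
      isOpen_Ioo.is_const_of_deriv_eq_zero isPreconnected_Ioo
        (fun s hs => (hg s hs).differentiableAt.differentiableWithinAt)
        (fun s hs => (hg s hs).deriv) hr hmid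
    have h3 := hconst _ h1
    have h4 := hconst _ h2
    set C := (M.h (M.R / 2) * deriv a (M.R / 2) + n * a (M.R / 2)) * E (M.R / 2) ^ n
    set D := (M.h (M.R / 2) * deriv a (M.R / 2) - n * a (M.R / 2)) / E (M.R / 2) ^ n
    -- Eliminating `h a'` between the two first integrals leaves `a` as a combination of `E⁻ⁿ` and
    -- `Eⁿ`.
    have h5 : ∀ r ∈ Ioo 0 M.R, 2 * n * a r * E r ^ n = C - D * (E r ^ n) ^ 2 := fun r hr => by
      have e1 := h3 r hr
      have e2 := h4 r hr
      rw [div_eq_iff (hEp r hr)] at e2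
      linear_combination e1 - E r ^ n * e2
    have hcont : ∀ g : ℝ → ℝ, ContinuousOn g (Icc 0 M.R) → ∀ r ∈ Icc 0 M.R,
        Tendsto g (nhdsWithin r (Ioo 0 M.R)) (nhds (g r)) := fun g hg r hr =>
      (hg r hr).mono Ioo_subset_Icc_self
    have hRm : M.R ∈ Icc 0 M.R := ⟨hR.le, le_rfl⟩
    have h0m : (0 : ℝ) ∈ Icc 0 M.R := ⟨le_rfl, hR.le⟩
    -- At the pole `a` and `E` both vanish, which removes the growing solution `E⁻ⁿ`.
    have hC : C = 0 := by
      have : (nhdsWithin M.R (Ioo 0 M.R)).NeBot := right_nhdsWithin_Ioo_neBot hR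
      have l1 := hcont _ ((hac.const_smul (2 * (n : ℝ))).mul (hEc.pow n)) M.R hRm
      have l2 := hcont _ (continuousOn_const (c := C) |>.sub
        ((continuousOn_const (c := D)).mul ((hEc.pow n).pow 2))) M.R hRm
      have l3 := tendsto_nhds_unique (l1.congr' (eventually_mem_nhdsWithin.mono h5)) l2
      simpa [haR, hER, hn0] using l3.symm
    have h6 : ∀ r ∈ Ioo 0 M.R, 2 * n * a r = -D * E r ^ n := fun r hr => by
      refine mul_right_cancel₀ (hEp r hr) ?_
      rw [h5 r hr, hC]
      ring
    -- At the boundary `E = 1` and `a = c`, which fixes the remaining constant.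
    have hD : 2 * n * c = -D := by
      have : (nhdsWithin 0 (Ioo 0 M.R)).NeBot := left_nhdsWithin_Ioo_neBot hR
      have l1 := hcont _ (hac.const_smul (2 * (n : ℝ))) 0 h0m
      have l2 := hcont _ ((continuousOn_const (c := -D)).mul (hEc.pow n)) 0 h0m
      have l3 := tendsto_nhds_unique (l1.congr' (eventually_mem_nhdsWithin.mono h6)) l2
      simpa [ha0, hE0] using l3
    intro r hr
    rcases eq_or_lt_of_le hr.1 with rfl | h
    · rw [ha0, hexp 0 hr, hE0]; simp
    · rw [hexp r hr]
      have h7 := h6 r ⟨h, hr.2⟩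
      rw [← hD] at h7
      have hnp : (2 * n : ℝ) ≠ 0 := by positivity
      refine mul_left_cancel₀ hnp ?_
      rw [h7]
      ring
  · rintro ⟨ha, haR⟩
    have haE : ∀ r ∈ Icc 0 M.R, a r = c * E r ^ n := fun r hr => by
      rcases eq_or_lt_of_le hr.2 with rfl | h
      · rw [haR, hER, zero_pow hn0, mul_zero]
      · rw [ha r ⟨hr.1, h⟩, hexp r ⟨hr.1, h⟩]
    have hda : ∀ r ∈ Ioo 0 M.R, HasDerivAt a (c * -(n * E r ^ n / M.h r)) r := fun r hr =>
      ((hEn r hr).const_mul c).congr_of_eventuallyEq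
        (Filter.mem_of_superset (Icc_mem_nhds hr.1 hr.2) haE)
    have hflux : ∀ r ∈ Ioo 0 M.R, HasDerivAt (fun s => M.h s * deriv a s)
        (-(c * n) * -(n * E r ^ n / M.h r)) r := fun r hr =>
      ((hEn r hr).const_mul (-(c * n))).congr_of_eventuallyEq
        (Filter.mem_of_superset (Ioo_mem_nhds hr.1 hr.2) fun s hs => by
          have := (M.h_pos s hs).ne'
          simp only [mem_ofPred_eq, (hda s hs).deriv]
          field_simp)
    refine ⟨(continuousOn_const.mul (hEc.pow n)).congr haE, fun r hr =>
      ⟨(hda r hr).differentiableAt, (hflux r hr).differentiableAt, ?_⟩, ?_, haR⟩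
    · rw [(hflux r hr).deriv, haE r (Ioo_subset_Icc_self hr)]
      ring
    · rw [haE 0 ⟨le_rfl, hR.le⟩, hE0, one_pow, mul_one]

end IsRadialProfile

end SurfaceOfRevolution

theorem propositionA1 (M : SurfaceOfRevolution) :
    -- the surface is Steklov isospectral to the unit disk
    (∀ k : ℕ, M.toDiskSurface.steklovEigenvalue k = unitDisk.steklovEigenvalue k) ∧
    -- both sequences are the full Steklov spectra, with multiplicities
    M.toDiskSurface.IsSteklovSpectrum M.toDiskSurface.steklovEigenvalue ∧
    unitDisk.IsSteklovSpectrum unitDisk.steklovEigenvalue ∧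
    -- the Dirichlet-to-Neumann maps are well defined and coincide
    (∃ Λ : CircleSmooth →ₗ[ℝ] CircleSmooth,
      M.toDiskSurface.IsDirichletToNeumann Λ ∧ unitDisk.IsDirichletToNeumann Λ) ∧
    -- the unique solution of the radial boundary value problem
    (∀ n : ℕ, 1 ≤ n → ∀ (c : ℝ) (a : ℝ → ℝ), M.IsRadialSolution n c a ↔
      (∀ r ∈ Set.Ico 0 M.R, a r = c * Real.exp (-(n * M.tau r))) ∧ a M.R = 0) ∧
    -- the harmonic functions of the form `a(r) cos(nθ)` or `a(r) sin(nθ)`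
    (∀ (n : ℕ) (T : ℝ → ℝ), (T = Real.cos ∨ (T = Real.sin ∧ 1 ≤ n)) →
      ∀ (a : ℝ → ℝ) (f : Plane → ℝ), ContinuousOn f M.dom →
        (∀ r ∈ Set.Icc 0 M.R, ∀ θ : ℝ, f ((M.R - r) • unitVec θ) = a r * T (n * θ)) →
        (M.toDiskSurface.IsHarmonic f ↔
          ∃ c : ℝ, ∀ r ∈ Set.Ico 0 M.R, a r = c * Real.exp (-(n * M.tau r))) ∧
        (M.toDiskSurface.IsHarmonic f → ∀ θ : ℝ,
          M.toDiskSurface.normalDeriv f (M.R • unitVec θ) = n * f (M.R • unitVec θ))) := by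
  obtain ⟨κ, ζ, Q, κ', ζ', Q', hp⟩ := M.exists_isRadialProfile
  -- The flat disk is handled as a surface of revolution, so the same chart argument computes its
  -- spectrum and Dirichlet-to-Neumann map.
  obtain ⟨κ₁, ζ₁, Q₁, κ₁', ζ₁', Q₁', hp₁⟩ := unitDiskRevolution.exists_isRadialProfile
  have hF := hp.isConformalChart
  have hF₁ : unitDisk.IsConformalChart (SurfaceOfRevolution.radialChart Q₁) := hp₁.isConformalChart
  exact ⟨fun k => by rw [hF.steklovEigenvalue_eq, hF₁.steklovEigenvalue_eq],
    hF.isSteklovSpectrum, hF₁.isSteklovSpectrum,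
    ⟨circleMultiplier, hF.isDirichletToNeumann, hF₁.isDirichletToNeumann⟩,
    fun n hn c a => hp.isRadialSolution_iff hn c a,
    fun n T hT a f hf hfa => hp.isHarmonic_iff hT hf hfa⟩
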